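/- Let $n\ge 2$ and let $\mathbb H^n$ be hyperbolic $n$-space with distance $d$ and hyperbolic volume $V$. A convex body in $\mathbb H^n$ is a compact, geodesically convex set with non-empty interior. A supporting hyperplane of a convex body $K$ is a hyperbolic hyperplane $H$ that meets $K$ and has $K$ in one of the two closed half-spaces that it bounds. The Lassak width of $K$ with respect to $H$ is $\max_{x\in K} d(x,H)$, and the minimal Lassak width $w(K)$ is the minimum of these widths over all supporting hyperplanes $H$ of $K$. Then for every $w>0$ and $n\ge 2$, $$\inf\{V(K) : K\subset\mathbb H^n \text{ a convex body with } w(K)\ge w\}=0.$$ Moreover, the following spindles witness this. There is a function $g:(0,\tfrac12)\to(1,\infty)$, independent of $n$, such that for every $n\geq 2$, every hyperbolic line $\ell\subset\mathbb H^n$ and every point $m\in\ell$, if $p_r,q_r$ denote the two points of $\ell$ with $d(p_r,m)=d(q_r,m)=g(r)$, and $K_r$ denotes the convex hull of $B(m,r)\cup\{p_r,q_r\}$, where $B(m,r)$ is the closed ball of center $m$ and radius $r$, then $K_r$ is a convex body and $w(K_r)\ge 1/r$ for all $r\in(0,\tfrac12)$; in particular, $\lim_{r\to0^+}w(K_r)=\infty$,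 while $\lim_{r\to 0^+}V(K_r)=0$. -/

import Mathlib

open MeasureTheory Set Filter Topology
open scoped ENNReal

noncomputable section

/-- Hyperbolic `n`-space in the Poincaré ball model: the open Euclidean unit ball of `ℝⁿ`, with the
Euclidean topology (which is also the topology of the hyperbolic distance `hypDist`). -/
abbrev HypSpace (n : ℕ) : Type :=
  Metric.ball (0 : EuclideanSpace ℝ (Fin n)) 1

/-- The hyperbolic distance of the Poincaré ball model. (The distance that `HypSpace n` inherits as a
subtype is the Euclidean one, and it is never used below.) -/
def hypDist {n : ℕ} (p q : HypSpace n) : ℝ :=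
  Real.arcosh (1 + 2 * ‖p.1 - q.1‖ ^ 2 / ((1 - ‖p.1‖ ^ 2) * (1 - ‖q.1‖ ^ 2)))

/-- The hyperbolic volume: the measure with density `(2 / (1 - ‖x‖²))ⁿ` with respect to the
Lebesgue measure on the unit ball. -/
def hypVolume (n : ℕ) : Measure (HypSpace n) :=
  (Measure.comap Subtype.val (volume : Measure (EuclideanSpace ℝ (Fin n)))).withDensity
    fun x => ENNReal.ofReal ((2 / (1 - ‖x.1‖ ^ 2)) ^ n)

/-- The closed hyperbolic ball of center `m` and radius `r`. -/
def hypClosedBall {n : ℕ} (m : HypSpace n) (r : ℝ) : Set (HypSpace n) :=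
  {x | hypDist m x ≤ r}

/-- The geodesic segment `[x, y]`: the points at which the triangle inequality is an equality. -/
def hypSegment {n : ℕ} (x y : HypSpace n) : Set (HypSpace n) :=
  {z | hypDist x z + hypDist z y = hypDist x y}

/-- Convexity: the geodesic segment between any two points of the set lies in the set. -/
def HypConvex {n : ℕ} (X : Set (HypSpace n)) : Prop :=
  ∀ x ∈ X, ∀ y ∈ X, hypSegment x y ⊆ X

/-- The convex hull: the smallest convex set containing `X`. -/
def hypConvexHull {n : ℕ} (X : Set (HypSpace n)) : Set (HypSpace n) :=
  ⋂₀ {C | HypConvex C ∧ X ⊆ C}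

/-- A convex body: a compact convex set with non-empty interior. -/
def IsHypConvexBody {n : ℕ} (K : Set (HypSpace n)) : Prop :=
  IsCompact K ∧ HypConvex K ∧ (interior K).Nonempty

/-- `H` is a hyperbolic hyperplane and `S` is one of the two closed half-spaces bounded by it.
A hyperplane is the trace on the open unit ball either of a linear hyperplane `u^⊥`, or of a sphere
with center `p` and radius `ρ` that is orthogonal to the unit sphere, that is, `‖p‖² = 1 + ρ²`.
(In the first case, both half-spaces are covered because `u` may be replaced by `-u`.) -/
def IsHypHalfSpace {n : ℕ} (S H : Set (HypSpace n)) : Prop :=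
  (∃ u : EuclideanSpace ℝ (Fin n), u ≠ 0 ∧
    H = {x | inner ℝ u x.1 = 0} ∧ S = {x | 0 ≤ inner ℝ u x.1}) ∨
  (∃ (p : EuclideanSpace ℝ (Fin n)) (ρ : ℝ), 0 < ρ ∧ ‖p‖ ^ 2 = 1 + ρ ^ 2 ∧
    H = {x | ‖x.1 - p‖ = ρ} ∧ (S = {x | ‖x.1 - p‖ ≤ ρ} ∨ S = {x | ρ ≤ ‖x.1 - p‖}))

/-- `H` is a supporting hyperplane of `K`: it meets `K`, and `K` lies in one of the two closed
half-spaces bounded by `H`. -/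
def IsHypSupportingHyperplane {n : ℕ} (K H : Set (HypSpace n)) : Prop :=
  (∃ S, IsHypHalfSpace S H ∧ K ⊆ S) ∧ (K ∩ H).Nonempty

/-- The hyperbolic distance of the point `x` from the set `H`. -/
def hypInfDist {n : ℕ} (x : HypSpace n) (H : Set (HypSpace n)) : ℝ :=
  sInf (hypDist x '' H)

/-- The Lassak width of `K` with respect to a supporting hyperplane `H`: the maximal distance of the
points of `K` from `H`. -/
def lassakWidthAt {n : ℕ} (K H : Set (HypSpace n)) : ℝ :=
  sSup ((fun x => hypInfDist x H) '' K)

/-- The minimal Lassak width `w(K)`: the smallest Lassak width of `K` with respect to its supporting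
hyperplanes. -/
def minLassakWidth {n : ℕ} (K : Set (HypSpace n)) : ℝ :=
  sInf (lassakWidthAt K '' {H | IsHypSupportingHyperplane K H})

/-- `γ` is a hyperbolic (geodesic) line, parametrized by arc length. -/
def IsHypLine {n : ℕ} (γ : ℝ → HypSpace n) : Prop :=
  ∀ s t : ℝ, hypDist (γ s) (γ t) = |s - t|

/-- The spindle on the line `γ` with midpoint `m = γ 0`: the convex hull of the ball `B(m, r)` and
the two points of the line at distance `a` from `m`. -/
def hypSpindle {n : ℕ} (γ : ℝ → HypSpace n) (r a : ℝ) : Set (HypSpace n) :=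
  hypConvexHull (hypClosedBall (γ 0) r ∪ {γ (-a), γ a})

end

/-! In the hyperboloid model a half-space is `0 ≤ ⟪N, ·⟫` with `⟪N, N⟫ = 1`, and the value at a
point is at most the sinh of its distance to the bounding hyperplane. If the half-space contains
`B(m, r)`, the value at `m` is at least `sinh r`. The values at the two spindle tips, at distance
`a` from `m`, average to `cosh a` times the value at `m`, so one tip has value at least `cosh a *
sinh r`. Hence the width is at least `1 / r` once `cosh a * sinh r ≥ sinh (1 / r)`: see
`le_minLassakWidth_of_line`.

The volume is bounded independently of `a`. The ball and the whole line lie in a convex set,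
`cuspNeighborhood`, each of whose points is within about `4 * r * exp (-|t|)` of some `γ t`. Balls
of radius `5 * r / (1 + r * i)` around `γ (± log (1 + r * i))` cover it. A ball of radius `ρ ≤ 1`
has volume at most a constant times `ρ ^ n`, and for `n ≥ 2` the total is at most a constant times
`∑ (r / (1 + r * i)) ^ 2 ≤ r ^ 2 + r`, which tends to zero. The tips can therefore be moved out as
far as the width requires.

Convexity and compactness are handled in Klein coordinates, where hyperbolic hulls become Euclidean
hulls. -/

/-- The Lorentz form on `ℝ × E`, negative definite on the first factor. -/
noncomputable def lorentzForm (E : Type*) [NormedAddCommGroup E] [InnerProductSpace ℝ E] :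
    (ℝ × E) →ₗ[ℝ] (ℝ × E) →ₗ[ℝ] ℝ :=
  LinearMap.mk₂ ℝ (fun X Y => inner ℝ X.2 Y.2 - X.1 * Y.1)
    (fun X Y Z => by simp only [Prod.snd_add, Prod.fst_add, inner_add_left]; ring)
    (fun c X Y => by
      simp only [Prod.smul_snd, Prod.smul_fst, inner_smul_left, smul_eq_mul]
      simp; ring)
    (fun X Y Z => by simp only [Prod.snd_add, Prod.fst_add, inner_add_right]; ring)
    (fun c X Y => by
      simp only [Prod.smul_snd, Prod.smul_fst, inner_smul_right, smul_eq_mul]; ring)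

/-! ### Lorentz form: definiteness and Cauchy–Schwarz on the orthogonal complement of a timelike
vector -/

section Lorentz

variable {E : Type*} [NormedAddCommGroup E] [InnerProductSpace ℝ E]

local notation "⟪" X ", " Y "⟫" => lorentzForm E X Y

theorem lorentzForm_apply (X Y : ℝ × E) : ⟪X, Y⟫ = inner ℝ X.2 Y.2 - X.1 * Y.1 := rfl

theorem lorentzForm_comm (X Y : ℝ × E) : ⟪X, Y⟫ = ⟪Y, X⟫ := by
  rw [lorentzForm_apply, lorentzForm_apply, real_inner_comm, mul_comm]

theorem continuous_lorentzForm_left (N : ℝ × E) : Continuous fun X : ℝ × E => ⟪N, X⟫ := by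
  simp only [lorentzForm_apply]
  fun_prop

/-- Orthogonality turns `V.1 * M.1` into an inner product, and Cauchy–Schwarz with `‖M.2‖ ^ 2 = M.1
^ 2 - 1` gives the estimate. It makes the form positive definite on the complement of `M`. -/
theorem lorentzForm_self_lower_bound {M V : ℝ × E} (hM : ⟪M, M⟫ = -1) (hV : ⟪V, M⟫ = 0) :
    ‖V.2‖ ^ 2 ≤ M.1 ^ 2 * ⟪V, V⟫ := by
  rw [lorentzForm_apply] at *
  rw [real_inner_self_eq_norm_sq] at *
  have h := real_inner_mul_inner_self_le V.2 M.2
  rw [real_inner_self_eq_norm_sq, real_inner_self_eq_norm_sq] at h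
  have h1 : inner ℝ V.2 M.2 = V.1 * M.1 := by linarith
  rw [h1] at h
  have h2 : ‖M.2‖ ^ 2 = M.1 ^ 2 - 1 := by linarith [sq M.1]
  rw [h2] at h
  nlinarith

theorem lorentzForm_self_nonneg {M V : ℝ × E} (hM : ⟪M, M⟫ = -1) (hV : ⟪V, M⟫ = 0) :
    0 ≤ ⟪V, V⟫ := by
  have h := lorentzForm_self_lower_bound hM hV
  have h0 : 0 < M.1 ^ 2 := by
    rw [lorentzForm_apply, real_inner_self_eq_norm_sq] at hM
    nlinarith [sq_nonneg ‖M.2‖]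
  have := (sq_nonneg ‖V.2‖).trans h
  exact nonneg_of_mul_nonneg_right this h0

theorem eq_zero_of_lorentzForm_self {M V : ℝ × E} (hM : ⟪M, M⟫ = -1) (hV : ⟪V, M⟫ = 0)
    (hVV : ⟪V, V⟫ = 0) : V = 0 := by
  have h := lorentzForm_self_lower_bound hM hV
  rw [hVV, mul_zero] at h
  have h2 : V.2 = 0 := by
    have : ‖V.2‖ ^ 2 = 0 := le_antisymm h (sq_nonneg _)
    simpa using this
  have h1 : V.1 = 0 := by
    rw [lorentzForm_apply, h2] at hVV
    simpa using hVV
  exact Prod.ext h1 h2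

theorem lorentzForm_sq_le {M V W : ℝ × E} (hM : ⟪M, M⟫ = -1) (hV : ⟪V, M⟫ = 0)
    (hW : ⟪W, M⟫ = 0) : ⟪V, W⟫ ^ 2 ≤ ⟪V, V⟫ * ⟪W, W⟫ := by
  have key : ∀ x : ℝ, 0 ≤ ⟪W, W⟫ * (x * x) + (2 * ⟪V, W⟫) * x + ⟪V, V⟫ := by
    intro x
    have h : ⟪V + x • W, M⟫ = 0 := by simp [hV, hW]
    have := lorentzForm_self_nonneg hM h
    simp only [map_add, map_smul, LinearMap.add_apply, LinearMap.smul_apply, smul_eq_mul,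
      lorentzForm_comm W V] at this
    linarith
  have := discrim_le_zero key
  rw [discrim] at this
  nlinarith

theorem abs_lorentzForm_le {M V W : ℝ × E} (hM : ⟪M, M⟫ = -1) (hV : ⟪V, M⟫ = 0)
    (hW : ⟪W, M⟫ = 0) : |⟪V, W⟫| ≤ √⟪V, V⟫ * √⟪W, W⟫ := by
  rw [← Real.sqrt_mul (lorentzForm_self_nonneg hM hV)]
  exact Real.abs_le_sqrt (lorentzForm_sq_le hM hV hW)

theorem sqrt_lorentzForm_add_le {M V W : ℝ × E} (hM : ⟪M, M⟫ = -1) (hV : ⟪V, M⟫ = 0)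
    (hW : ⟪W, M⟫ = 0) : √⟪V + W, V + W⟫ ≤ √⟪V, V⟫ + √⟪W, W⟫ := by
  have h := (le_abs_self _).trans (abs_lorentzForm_le hM hV hW)
  rw [Real.sqrt_le_left (by positivity), add_sq, Real.sq_sqrt (lorentzForm_self_nonneg hM hV),
    Real.sq_sqrt (lorentzForm_self_nonneg hM hW)]
  simp only [map_add, LinearMap.add_apply, lorentzForm_comm W V]
  linarith

theorem sqrt_lorentzForm_smul {a : ℝ} (ha : 0 ≤ a) (V : ℝ × E) :
    √⟪a • V, a • V⟫ = a * √⟪V, V⟫ := by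
  simp only [map_smul, LinearMap.smul_apply, smul_eq_mul]
  rw [← mul_assoc, Real.sqrt_mul (by positivity), Real.sqrt_mul_self ha]

end Lorentz

/-! ### Hyperboloid model: distances, triangle inequality, geodesic segments -/

section Hyperboloid

variable {n : ℕ}

local notation "⟪" X ", " Y "⟫" => lorentzForm (EuclideanSpace ℝ (Fin n)) X Y

/-- The point of the hyperboloid model corresponding to a point of the Poincaré ball model. -/
noncomputable def toHyperboloid (x : HypSpace n) : ℝ × EuclideanSpace ℝ (Fin n) :=
  ((1 + ‖x.1‖ ^ 2) / (1 - ‖x.1‖ ^ 2), (2 / (1 - ‖x.1‖ ^ 2)) • x.1)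

theorem one_sub_norm_sq_pos (x : HypSpace n) : 0 < 1 - ‖x.1‖ ^ 2 := by
  have h : ‖x.1‖ < 1 := mem_ball_zero_iff.1 x.2
  nlinarith [norm_nonneg x.1]

theorem toHyperboloid_fst_pos (x : HypSpace n) : 0 < (toHyperboloid x).1 :=
  div_pos (by positivity) (one_sub_norm_sq_pos x)

theorem continuous_toHyperboloid : Continuous (toHyperboloid (n := n)) := by
  have h : ∀ x : HypSpace n, 1 - ‖x.1‖ ^ 2 ≠ 0 := fun x => (one_sub_norm_sq_pos x).ne'
  refine Continuous.prodMk ?_ ?_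
  · exact Continuous.div (by fun_prop) (by fun_prop) h
  · exact Continuous.smul (Continuous.div (by fun_prop) (by fun_prop) h) (by fun_prop)

theorem lorentzForm_toHyperboloid (N : ℝ × EuclideanSpace ℝ (Fin n)) (x : HypSpace n) :
    ⟪N, toHyperboloid x⟫ =
      (2 * inner ℝ N.2 x.1 - N.1 * (1 + ‖x.1‖ ^ 2)) / (1 - ‖x.1‖ ^ 2) := by
  have h := (one_sub_norm_sq_pos x).ne'
  simp only [lorentzForm_apply, toHyperboloid, inner_smul_right]
  field_simp

theorem neg_lorentzForm_toHyperboloid (x y : HypSpace n) :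
    -⟪toHyperboloid x, toHyperboloid y⟫ =
      1 + 2 * ‖x.1 - y.1‖ ^ 2 / ((1 - ‖x.1‖ ^ 2) * (1 - ‖y.1‖ ^ 2)) := by
  have hx := (one_sub_norm_sq_pos x).ne'
  have hy := (one_sub_norm_sq_pos y).ne'
  rw [lorentzForm_toHyperboloid, norm_sub_sq_real]
  simp only [toHyperboloid, inner_smul_left]
  simp only [conj_trivial]
  field_simp
  ring

theorem one_le_neg_lorentzForm (x y : HypSpace n) :
    1 ≤ -⟪toHyperboloid x, toHyperboloid y⟫ := by
  have hx := one_sub_norm_sq_pos x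
  have hy := one_sub_norm_sq_pos y
  rw [neg_lorentzForm_toHyperboloid]
  have : 0 ≤ 2 * ‖x.1 - y.1‖ ^ 2 / ((1 - ‖x.1‖ ^ 2) * (1 - ‖y.1‖ ^ 2)) := by positivity
  linarith

@[simp]
theorem lorentzForm_toHyperboloid_self (x : HypSpace n) :
    ⟪toHyperboloid x, toHyperboloid x⟫ = -1 := by
  have h := neg_lorentzForm_toHyperboloid x x
  simp only [sub_self, norm_zero] at h
  simp at h
  linarith

theorem hypDist_eq (x y : HypSpace n) :
    hypDist x y = Real.arcosh (-⟪toHyperboloid x, toHyperboloid y⟫) := by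
  rw [neg_lorentzForm_toHyperboloid, hypDist]

theorem hypDist_nonneg (x y : HypSpace n) : 0 ≤ hypDist x y := by
  rw [hypDist_eq]
  exact Real.arcosh_nonneg (one_le_neg_lorentzForm x y)

theorem cosh_hypDist (x y : HypSpace n) :
    Real.cosh (hypDist x y) = -⟪toHyperboloid x, toHyperboloid y⟫ := by
  rw [hypDist_eq, Real.cosh_arcosh (one_le_neg_lorentzForm x y)]

theorem lorentzForm_eq_neg_cosh (x y : HypSpace n) :
    ⟪toHyperboloid x, toHyperboloid y⟫ = -Real.cosh (hypDist x y) := by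
  rw [cosh_hypDist, neg_neg]

theorem hypDist_comm (x y : HypSpace n) : hypDist x y = hypDist y x := by
  rw [hypDist_eq, hypDist_eq, lorentzForm_comm]

@[simp]
theorem hypDist_self (x : HypSpace n) : hypDist x x = 0 := by
  rw [hypDist_eq]
  simp

theorem hypDist_le_iff {x y : HypSpace n} {r : ℝ} (hr : 0 ≤ r) :
    hypDist x y ≤ r ↔ -⟪toHyperboloid x, toHyperboloid y⟫ ≤ Real.cosh r := by
  rw [← cosh_hypDist, Real.cosh_le_cosh, abs_of_nonneg (hypDist_nonneg x y), abs_of_nonneg hr]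

theorem toHyperboloid_injective : Function.Injective (toHyperboloid (n := n)) := by
  intro x y h
  have h1 := neg_lorentzForm_toHyperboloid x y
  rw [← h, lorentzForm_toHyperboloid_self] at h1
  have hx := one_sub_norm_sq_pos x
  have hy := one_sub_norm_sq_pos y
  have h2 : 2 * ‖x.1 - y.1‖ ^ 2 / ((1 - ‖x.1‖ ^ 2) * (1 - ‖y.1‖ ^ 2)) = 0 := by linarith
  rw [div_eq_zero_iff] at h2
  rcases h2 with h2 | h2
  · have : ‖x.1 - y.1‖ ^ 2 = 0 := by linarith
    have : x.1 - y.1 = 0 := by simpa using this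
    exact Subtype.ext (sub_eq_zero.1 this)
  · exact absurd h2 (by positivity)

theorem eq_of_hypDist_eq_zero {x y : HypSpace n} (h : hypDist x y = 0) : x = y := by
  have h1 := cosh_hypDist x y
  rw [h, Real.cosh_zero] at h1
  have h3 : toHyperboloid y - toHyperboloid x = 0 := by
    refine eq_zero_of_lorentzForm_self (lorentzForm_toHyperboloid_self x) ?_ ?_
    · simp [lorentzForm_comm (toHyperboloid y)]; linarith
    · simp [lorentzForm_comm (toHyperboloid y)]; linarith
  exact (toHyperboloid_injective (sub_eq_zero.1 h3)).symm

/-- The preimage is the stereographic projection `v / (1 + t)` of `X = (t, v)`. -/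
theorem exists_toHyperboloid_eq {X : ℝ × EuclideanSpace ℝ (Fin n)} (h0 : 0 < X.1)
    (hX : ⟪X, X⟫ = -1) : ∃ x : HypSpace n, toHyperboloid x = X := by
  obtain ⟨t, v⟩ := X
  simp only at h0
  rw [lorentzForm_apply, real_inner_self_eq_norm_sq] at hX
  simp only at hX
  have hv : ‖v‖ ^ 2 = t ^ 2 - 1 := by linarith [sq t]
  have ht : (0 : ℝ) < 1 + t := by linarith
  have hn : ‖(1 + t)⁻¹ • v‖ ^ 2 = (t - 1) / (1 + t) := by
    rw [norm_smul, mul_pow, hv, Real.norm_eq_abs, sq_abs]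
    field_simp
    ring
  have hlt : ‖(1 + t)⁻¹ • v‖ ^ 2 < 1 := by
    rw [hn, div_lt_one ht]
    linarith
  refine ⟨⟨(1 + t)⁻¹ • v, ?_⟩, ?_⟩
  · rw [mem_ball_zero_iff]
    nlinarith [norm_nonneg ((1 + t)⁻¹ • v)]
  · have hd : 1 - (t - 1) / (1 + t) = 2 / (1 + t) := by
      field_simp
      ring
    simp only [toHyperboloid, hn, hd]
    refine Prod.ext ?_ ?_
    · simp only
      field_simp
      ring
    · simp only [smul_smul]
      have : 2 / (2 / (1 + t)) * (1 + t)⁻¹ = 1 := by field_simp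
      rw [this, one_smul]

/-- The components orthogonal to `z` control the deviation from `cosh · cosh`. -/
theorem abs_lorentzForm_add_cosh_mul_cosh_le (x y z : HypSpace n) :
    |⟪toHyperboloid x, toHyperboloid y⟫ + Real.cosh (hypDist x z) * Real.cosh (hypDist z y)| ≤
      Real.sinh (hypDist x z) * Real.sinh (hypDist z y) := by
  set c := Real.cosh (hypDist x z) with hc
  set d := Real.cosh (hypDist z y) with hd
  have hxz : ⟪toHyperboloid x, toHyperboloid z⟫ = -c := lorentzForm_eq_neg_cosh x z
  have hzy : ⟪toHyperboloid z, toHyperboloid y⟫ = -d := lorentzForm_eq_neg_cosh z y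
  have hyz : ⟪toHyperboloid y, toHyperboloid z⟫ = -d := by rw [lorentzForm_comm, hzy]
  have hzx : ⟪toHyperboloid z, toHyperboloid x⟫ = -c := by rw [lorentzForm_comm, hxz]
  have h := abs_lorentzForm_le (lorentzForm_toHyperboloid_self z)
    (V := toHyperboloid x - c • toHyperboloid z) (W := toHyperboloid y - d • toHyperboloid z)
    (by simp [hxz]) (by simp [hyz])
  have e1 : ⟪toHyperboloid x - c • toHyperboloid z, toHyperboloid y - d • toHyperboloid z⟫ =
      ⟪toHyperboloid x, toHyperboloid y⟫ + c * d := by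
    simp [hxz, hzy]; ring
  have e2 : ⟪toHyperboloid x - c • toHyperboloid z, toHyperboloid x - c • toHyperboloid z⟫ =
      Real.sinh (hypDist x z) ^ 2 := by
    rw [Real.sinh_sq, ← hc]; simp [hxz, hzx]; ring
  have e3 : ⟪toHyperboloid y - d • toHyperboloid z, toHyperboloid y - d • toHyperboloid z⟫ =
      Real.sinh (hypDist z y) ^ 2 := by
    rw [Real.sinh_sq, ← hd]; simp [hyz, hzy]; ring
  rw [e1, e2, e3, Real.sqrt_sq (Real.sinh_nonneg_iff.2 (hypDist_nonneg _ _)),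
    Real.sqrt_sq (Real.sinh_nonneg_iff.2 (hypDist_nonneg _ _))] at h
  exact h

theorem hypDist_triangle (x z y : HypSpace n) : hypDist x y ≤ hypDist x z + hypDist z y := by
  rw [hypDist_le_iff (add_nonneg (hypDist_nonneg _ _) (hypDist_nonneg _ _)), Real.cosh_add]
  have := (abs_le.1 (abs_lorentzForm_add_cosh_mul_cosh_le x y z)).1
  linarith

/-- As `N` is orthogonal to `y`, only the component of `x` orthogonal to `y` contributes; its length
is `sinh (hypDist x y)`. -/
theorem abs_lorentzForm_le_sinh_hypDist {N : ℝ × EuclideanSpace ℝ (Fin n)} (hN : ⟪N, N⟫ = 1)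
    {x y : HypSpace n} (hy : ⟪N, toHyperboloid y⟫ = 0) :
    |⟪N, toHyperboloid x⟫| ≤ Real.sinh (hypDist x y) := by
  set c := Real.cosh (hypDist x y) with hc
  have hxy : ⟪toHyperboloid x, toHyperboloid y⟫ = -c := lorentzForm_eq_neg_cosh x y
  have hyx : ⟪toHyperboloid y, toHyperboloid x⟫ = -c := by rw [lorentzForm_comm, hxy]
  have h := abs_lorentzForm_le (lorentzForm_toHyperboloid_self y)
    (V := N) (W := toHyperboloid x - c • toHyperboloid y) hy (by simp [hxy])
  have e2 : ⟪toHyperboloid x - c • toHyperboloid y, toHyperboloid x - c • toHyperboloid y⟫ =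
      Real.sinh (hypDist x y) ^ 2 := by
    rw [Real.sinh_sq, ← hc]; simp [hxy, hyx]; ring
  rw [e2, hN, Real.sqrt_sq (Real.sinh_nonneg_iff.2 (hypDist_nonneg _ _))] at h
  simpa [hy] using h

/-- If a half-space contains a ball, its signed distance function is large at the center. -/
theorem sinh_le_lorentzForm_of_closedBall_subset {N : ℝ × EuclideanSpace ℝ (Fin n)}
    (hN : ⟪N, N⟫ = 1) {m : HypSpace n} {r : ℝ} (hr : 0 ≤ r)
    (h : ∀ x ∈ hypClosedBall m r, 0 ≤ ⟪N, toHyperboloid x⟫) :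
    Real.sinh r ≤ ⟪N, toHyperboloid m⟫ := by
  set s := ⟪N, toHyperboloid m⟫ with hs
  have hms : ⟪toHyperboloid m, N⟫ = s := lorentzForm_comm _ _
  set M := toHyperboloid m with hM
  have hMM : ⟪M, M⟫ = -1 := lorentzForm_toHyperboloid_self m
  set q := √(1 + s ^ 2) with hq
  have hq0 : 0 < q := by positivity
  have hqq : q ^ 2 = 1 + s ^ 2 := Real.sq_sqrt (by positivity)
  -- `N + s • M` is the component of `N` orthogonal to `M`, of length `q`; thus `X` is the point
  -- reached from `m` by moving a distance `r` straight against `N`.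
  set X := Real.cosh r • M - (Real.sinh r / q) • (N + s • M) with hX
  have hXM : ⟪X, M⟫ = -Real.cosh r := by
    simp [hX, hMM, ← hs]
  have hXX : ⟪X, X⟫ = -1 := by
    have hcs := Real.cosh_sq r
    simp only [hX, map_add, map_sub, map_smul, LinearMap.add_apply, LinearMap.sub_apply,
      LinearMap.smul_apply, smul_eq_mul, hMM, ← hs, hms, hN]
    field_simp
    rw [hqq]
    linear_combination (-Real.cosh r ^ 2) * hqq - (1 + s ^ 2) * hcs
  -- On the lower sheet the form with `M` would be nonnegative, but it is `-cosh r`.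
  have hX0 : 0 < X.1 := by
    by_contra hneg
    have hM1 : 0 < M.1 := toHyperboloid_fst_pos m
    have hc := Real.one_le_cosh r
    rw [lorentzForm_apply] at hXM hXX hMM
    rw [real_inner_self_eq_norm_sq] at hXX hMM
    have h1 : ‖X.2‖ ≤ -X.1 := by nlinarith [norm_nonneg X.2]
    have h2 : ‖M.2‖ ≤ M.1 := by nlinarith [norm_nonneg M.2]
    have h3 := (abs_le.1 (abs_real_inner_le_norm X.2 M.2)).1
    have h4 : ‖X.2‖ * ‖M.2‖ ≤ -X.1 * M.1 :=
      mul_le_mul h1 h2 (norm_nonneg _) (by linarith)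
    nlinarith
  obtain ⟨x, hx⟩ := exists_toHyperboloid_eq hX0 hXX
  have hxm : x ∈ hypClosedBall m r := by
    change hypDist m x ≤ r
    rw [hypDist_comm, hypDist_le_iff hr, hx, ← hM, hXM, neg_neg]
  have h1 := h x hxm
  rw [hx] at h1
  have h2 : ⟪N, X⟫ = Real.cosh r * s - Real.sinh r * q := by
    simp only [hX, map_add, map_sub, map_smul, smul_eq_mul, ← hs, hN]
    field_simp
    linear_combination Real.sinh r * hqq
  rw [h2] at h1
  have hsr := Real.sinh_nonneg_iff.2 hr
  have hcr := Real.cosh_pos r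
  have hs0 : 0 ≤ s := by
    by_contra hneg
    have : Real.cosh r * s < 0 := mul_neg_of_pos_of_neg hcr (by linarith)
    nlinarith [mul_nonneg hsr hq0.le]
  have h3 : (Real.sinh r * q) ^ 2 ≤ (Real.cosh r * s) ^ 2 :=
    pow_le_pow_left₀ (by positivity) (by linarith) 2
  rw [mul_pow, mul_pow, hqq, Real.cosh_sq] at h3
  nlinarith

/-- The points of a segment are the nonnegative combinations of its end points. -/
theorem mem_hypSegment_iff {x y z : HypSpace n} :
    z ∈ hypSegment x y ↔ ∃ a b : ℝ, 0 ≤ a ∧ 0 ≤ b ∧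
      toHyperboloid z = a • toHyperboloid x + b • toHyperboloid y := by
  set d := hypDist x y with hd
  have hxy : ⟪toHyperboloid x, toHyperboloid y⟫ = -Real.cosh d := lorentzForm_eq_neg_cosh x y
  have hyx : ⟪toHyperboloid y, toHyperboloid x⟫ = -Real.cosh d := by rw [lorentzForm_comm, hxy]
  have hd0 : 0 ≤ d := hypDist_nonneg x y
  constructor
  · intro h
    change hypDist x z + hypDist z y = d at h
    have hA0 := hypDist_nonneg x z
    have hB0 := hypDist_nonneg z y
    have hzx : ⟪toHyperboloid z, toHyperboloid x⟫ = -Real.cosh (hypDist x z) := by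
      rw [lorentzForm_comm, lorentzForm_eq_neg_cosh]
    have hzy : ⟪toHyperboloid z, toHyperboloid y⟫ = -Real.cosh (hypDist z y) :=
      lorentzForm_eq_neg_cosh z y
    have hxz : ⟪toHyperboloid x, toHyperboloid z⟫ = -Real.cosh (hypDist x z) :=
      lorentzForm_eq_neg_cosh x z
    have hyz : ⟪toHyperboloid y, toHyperboloid z⟫ = -Real.cosh (hypDist z y) := by
      rw [lorentzForm_comm, hzy]
    set A := hypDist x z
    set B := hypDist z y
    rcases hd0.eq_or_lt with hd1 | hd1
    · have hA : A = 0 := by linarith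
      refine ⟨1, 0, zero_le_one, le_rfl, ?_⟩
      rw [eq_of_hypDist_eq_zero hA]
      simp
    · have hs : 0 < Real.sinh d := Real.sinh_pos_iff.2 hd1
      -- Weights of the point at distances `A` and `B` from the ends of a geodesic of length `d = A
      -- + B`. The difference of the two sides is then orthogonal to `z` and has zero square, so it
      -- vanishes.
      refine ⟨Real.sinh B / Real.sinh d, Real.sinh A / Real.sinh d,
        div_nonneg (Real.sinh_nonneg_iff.2 hB0) hs.le,
        div_nonneg (Real.sinh_nonneg_iff.2 hA0) hs.le, ?_⟩
      have cA := Real.cosh_sq A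
      have cB := Real.cosh_sq B
      have hsd : Real.sinh d = Real.sinh A * Real.cosh B + Real.cosh A * Real.sinh B := by
        rw [← h, Real.sinh_add]
      have hcd : Real.cosh d = Real.cosh A * Real.cosh B + Real.sinh A * Real.sinh B := by
        rw [← h, Real.cosh_add]
      set a := Real.sinh B / Real.sinh d with ha
      set b := Real.sinh A / Real.sinh d with hb
      have e1 : a * Real.cosh A + b * Real.cosh B = 1 := by
        rw [ha, hb]; field_simp; rw [hsd]; ring
      have e2 : a + b * Real.cosh d = Real.cosh A := by
        rw [ha, hb]; field_simp; rw [hsd, hcd]; linear_combination (-Real.sinh B) * cA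
      have e3 : a * Real.cosh d + b = Real.cosh B := by
        rw [ha, hb]; field_simp; rw [hsd, hcd]; linear_combination (-Real.sinh A) * cB
      refine sub_eq_zero.1
        (eq_zero_of_lorentzForm_self (lorentzForm_toHyperboloid_self z) ?_ ?_)
      · simp only [map_add, map_sub, map_smul, LinearMap.add_apply, LinearMap.sub_apply,
          LinearMap.smul_apply, smul_eq_mul, hxz, hyz, lorentzForm_toHyperboloid_self]
        linarith
      · simp only [map_add, map_sub, map_smul, LinearMap.add_apply, LinearMap.sub_apply,
          LinearMap.smul_apply, smul_eq_mul, hxz, hyz, hzx, hzy, hxy, hyx,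
          lorentzForm_toHyperboloid_self]
        linear_combination e1 - a * e2 - b * e3
  · rintro ⟨a, b, ha, hb, h⟩
    have h1 : a ^ 2 + b ^ 2 + 2 * a * b * Real.cosh d = 1 := by
      have := lorentzForm_toHyperboloid_self z
      rw [h] at this
      simp only [map_add, map_smul, LinearMap.add_apply,
          LinearMap.smul_apply, smul_eq_mul, hxy, hyx, lorentzForm_toHyperboloid_self] at this
      linarith
    have hA : Real.cosh (hypDist x z) = a + b * Real.cosh d := by
      rw [cosh_hypDist, h]
      simp only [map_add, map_smul, smul_eq_mul, hxy, lorentzForm_toHyperboloid_self]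
      ring
    have hB : Real.cosh (hypDist z y) = a * Real.cosh d + b := by
      rw [hypDist_comm, cosh_hypDist, h]
      simp only [map_add, map_smul, smul_eq_mul, hyx, lorentzForm_toHyperboloid_self]
      ring
    have hs := Real.sinh_nonneg_iff.2 hd0
    have hcs := Real.cosh_sq d
    have sA : Real.sinh (hypDist x z) = b * Real.sinh d := by
      rw [← sq_eq_sq₀ (Real.sinh_nonneg_iff.2 (hypDist_nonneg _ _)) (by positivity),
        Real.sinh_sq, hA]
      linear_combination h1 + b ^ 2 * hcs
    have sB : Real.sinh (hypDist z y) = a * Real.sinh d := by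
      rw [← sq_eq_sq₀ (Real.sinh_nonneg_iff.2 (hypDist_nonneg _ _)) (by positivity),
        Real.sinh_sq, hB]
      linear_combination h1 + a ^ 2 * hcs
    change hypDist x z + hypDist z y = d
    refine Real.cosh_strictMonoOn.injOn
      (add_nonneg (hypDist_nonneg x z) (hypDist_nonneg z y)) hd0 ?_
    rw [Real.cosh_add, hA, hB, sA, sB]
    linear_combination Real.cosh d * h1 - a * b * hcs

end Hyperboloid

/-! ### Klein model: convex hulls, compactness, and the spindle as a convex body -/

section KleinModel

variable {n : ℕ}

local notation "⟪" X ", " Y "⟫" => lorentzForm (EuclideanSpace ℝ (Fin n)) X Y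

/-- The coordinates of the Klein model, in which convexity is Euclidean convexity. -/
noncomputable def toKlein (x : HypSpace n) : EuclideanSpace ℝ (Fin n) :=
  (2 / (1 + ‖x.1‖ ^ 2)) • x.1

theorem continuous_klein_formula :
    Continuous fun x : EuclideanSpace ℝ (Fin n) => (2 / (1 + ‖x‖ ^ 2)) • x := by
  have h : ∀ x : EuclideanSpace ℝ (Fin n), 1 + ‖x‖ ^ 2 ≠ 0 := fun x => by positivity
  exact Continuous.smul (Continuous.div (by fun_prop) (by fun_prop) h) continuous_id

theorem continuous_toKlein : Continuous (toKlein (n := n)) :=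
  continuous_klein_formula.comp continuous_subtype_val

theorem toHyperboloid_snd (x : HypSpace n) :
    (toHyperboloid x).2 = (toHyperboloid x).1 • toKlein x := by
  have h := (one_sub_norm_sq_pos x).ne'
  have h' : 1 + ‖x.1‖ ^ 2 ≠ 0 := by positivity
  simp only [toHyperboloid, toKlein, smul_smul]
  congr 1
  field_simp

theorem toHyperboloid_eq_smul (x : HypSpace n) :
    toHyperboloid x = (toHyperboloid x).1 • ((1 : ℝ), toKlein x) :=
  Prod.ext (by simp) (by simp [toHyperboloid_snd])

theorem toHyperboloid_fst_sq_mul (x : HypSpace n) :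
    (toHyperboloid x).1 ^ 2 * (1 - ‖toKlein x‖ ^ 2) = 1 := by
  have h := lorentzForm_toHyperboloid_self x
  rw [lorentzForm_apply, toHyperboloid_snd, real_inner_self_eq_norm_sq, norm_smul, mul_pow,
    Real.norm_eq_abs, sq_abs] at h
  linarith

theorem norm_toKlein_lt_one (x : HypSpace n) : ‖toKlein x‖ < 1 := by
  have h := toHyperboloid_fst_sq_mul x
  have h1 := sq_nonneg (toHyperboloid x).1
  by_contra hx
  have : 1 - ‖toKlein x‖ ^ 2 ≤ 0 := by nlinarith
  nlinarith

theorem toKlein_eq_of_toHyperboloid_eq_smul {x : HypSpace n} {c : ℝ}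
    {k : EuclideanSpace ℝ (Fin n)} (h : toHyperboloid x = c • ((1 : ℝ), k)) : toKlein x = k := by
  have h1 : (toHyperboloid x).1 = c := by rw [h]; simp
  have h2 : (toHyperboloid x).2 = c • k := by rw [h]; simp
  have h0 := toHyperboloid_fst_pos x
  rw [toHyperboloid_snd, h1] at h2
  rw [h1] at h0
  exact smul_right_injective _ h0.ne' h2

theorem toKlein_injective : Function.Injective (toKlein (n := n)) := by
  intro x y h
  apply toHyperboloid_injective
  have hx := toHyperboloid_fst_sq_mul x
  have hy := toHyperboloid_fst_sq_mul y
  rw [h] at hx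
  have h1 : (1 - ‖toKlein y‖ ^ 2) ≠ 0 := by
    intro h0
    simp [h0] at hy
  have h2 : (toHyperboloid x).1 ^ 2 = (toHyperboloid y).1 ^ 2 :=
    mul_right_cancel₀ h1 (hx.trans hy.symm)
  rw [sq_eq_sq₀ (toHyperboloid_fst_pos x).le (toHyperboloid_fst_pos y).le] at h2
  rw [toHyperboloid_eq_smul x, toHyperboloid_eq_smul y, h, h2]

theorem exists_toHyperboloid_eq_smul {k : EuclideanSpace ℝ (Fin n)} (hk : ‖k‖ < 1) :
    ∃ (x : HypSpace n) (c : ℝ), 0 < c ∧ toHyperboloid x = c • ((1 : ℝ), k) := by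
  have h1 : 0 < 1 - ‖k‖ ^ 2 := by nlinarith [norm_nonneg k]
  have hc : 0 < (√(1 - ‖k‖ ^ 2))⁻¹ := by positivity
  obtain ⟨x, hx⟩ := exists_toHyperboloid_eq (X := (√(1 - ‖k‖ ^ 2))⁻¹ • ((1 : ℝ), k))
    (by simpa using h1) (by
      rw [lorentzForm_apply, real_inner_self_eq_norm_sq]
      simp only [Prod.smul_mk, norm_smul, Real.norm_eq_abs, mul_pow, sq_abs, smul_eq_mul, mul_one]
      rw [← sq, inv_pow, Real.sq_sqrt h1.le]
      field_simp
      ring)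
  exact ⟨x, _, hc, hx⟩

/-- Segments consist of nonnegative combinations on the hyperboloid; central projection to height
one turns these into Euclidean convex combinations, up to rescaled weights. -/
theorem HypConvex.convex_image_toKlein {C : Set (HypSpace n)} (hC : HypConvex C) :
    Convex ℝ (toKlein '' C) := by
  rintro _ ⟨x, hx, rfl⟩ _ ⟨y, hy, rfl⟩ a b ha hb hab
  have hk : ‖a • toKlein x + b • toKlein y‖ < 1 := by
    have := (convex_ball (0 : EuclideanSpace ℝ (Fin n)) 1)
      (mem_ball_zero_iff.2 (norm_toKlein_lt_one x)) (mem_ball_zero_iff.2 (norm_toKlein_lt_one y))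
      ha hb hab
    exact mem_ball_zero_iff.1 this
  obtain ⟨z, c, hc, hz⟩ := exists_toHyperboloid_eq_smul hk
  have hx0 := toHyperboloid_fst_pos x
  have hy0 := toHyperboloid_fst_pos y
  refine ⟨z, hC x hx y hy (mem_hypSegment_iff.2 ⟨c * a / (toHyperboloid x).1,
    c * b / (toHyperboloid y).1, by positivity, by positivity, ?_⟩),
    toKlein_eq_of_toHyperboloid_eq_smul hz⟩
  rw [hz]
  refine Prod.ext ?_ ?_
  · simp only [Prod.smul_mk, Prod.fst_add, Prod.smul_fst, smul_eq_mul]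
    field_simp
    linarith
  · simp only [Prod.smul_mk, Prod.snd_add, Prod.smul_snd, toHyperboloid_snd, smul_add, smul_smul]
    congr 2 <;> field_simp

theorem hypConvex_preimage_toKlein {D : Set (EuclideanSpace ℝ (Fin n))} (hD : Convex ℝ D) :
    HypConvex (toKlein ⁻¹' D) := by
  intro x hx y hy z hz
  obtain ⟨a, b, ha, hb, h⟩ := mem_hypSegment_iff.1 hz
  have hx0 := toHyperboloid_fst_pos x
  have hy0 := toHyperboloid_fst_pos y
  have hz0 := toHyperboloid_fst_pos z
  have h1 : (toHyperboloid z).1 = a * (toHyperboloid x).1 + b * (toHyperboloid y).1 := by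
    rw [h]; simp
  have h2 : toKlein z = (a * (toHyperboloid x).1 / (toHyperboloid z).1) • toKlein x +
      (b * (toHyperboloid y).1 / (toHyperboloid z).1) • toKlein y := by
    apply smul_right_injective _ hz0.ne'
    change (toHyperboloid z).1 • toKlein z = (toHyperboloid z).1 • (_ + _)
    rw [← toHyperboloid_snd, smul_add, smul_smul, smul_smul, mul_div_cancel₀ _ hz0.ne',
      mul_div_cancel₀ _ hz0.ne', mul_smul, mul_smul, ← toHyperboloid_snd, ← toHyperboloid_snd, h]
    simp
  change toKlein z ∈ D
  rw [h2]
  refine hD hx hy (by positivity) (by positivity) ?_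
  rw [← add_div, ← h1, div_self hz0.ne']

theorem hypConvexHull_eq (G : Set (HypSpace n)) :
    hypConvexHull G = toKlein ⁻¹' (convexHull ℝ (toKlein '' G)) := by
  apply Subset.antisymm
  · exact sInter_subset_of_mem ⟨hypConvex_preimage_toKlein (convex_convexHull ℝ _),
      fun x hx => subset_convexHull ℝ _ (mem_image_of_mem _ hx)⟩
  · rintro x hx C ⟨hC, hGC⟩
    obtain ⟨y, hy, hyx⟩ := convexHull_min (image_mono hGC) hC.convex_image_toKlein hx
    rwa [← toKlein_injective hyx]

theorem hypConvex_hypConvexHull (G : Set (HypSpace n)) : HypConvex (hypConvexHull G) := by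
  rw [hypConvexHull_eq]
  exact hypConvex_preimage_toKlein (convex_convexHull ℝ _)

theorem subset_hypConvexHull (G : Set (HypSpace n)) : G ⊆ hypConvexHull G :=
  subset_sInter fun _ hC => hC.2

theorem hypConvexHull_subset {G C : Set (HypSpace n)} (hC : HypConvex C) (h : G ⊆ C) :
    hypConvexHull G ⊆ C :=
  sInter_subset_of_mem ⟨hC, h⟩

/-- The Klein formula extends continuously to the closed ball and fixes the unit sphere, which `D`
misses; so the preimage is closed in a compact ball. -/
theorem isCompact_preimage_toKlein {D : Set (EuclideanSpace ℝ (Fin n))} (hD : IsCompact D)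
    (h1 : ∀ k ∈ D, ‖k‖ < 1) : IsCompact (toKlein ⁻¹' D) := by
  rw [Subtype.isCompact_iff]
  have h : Subtype.val '' (toKlein ⁻¹' D) = Metric.closedBall 0 1 ∩
      (fun x : EuclideanSpace ℝ (Fin n) => (2 / (1 + ‖x‖ ^ 2)) • x) ⁻¹' D := by
    ext x
    constructor
    · rintro ⟨y, hy, rfl⟩
      exact ⟨Metric.ball_subset_closedBall y.2, hy⟩
    · rintro ⟨hx, hxD⟩
      have hx1 : ‖x‖ ≤ 1 := mem_closedBall_zero_iff.1 hx
      rcases hx1.lt_or_eq with hlt | heq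
      · exact ⟨⟨x, mem_ball_zero_iff.2 hlt⟩, hxD, rfl⟩
      · have := h1 _ hxD
        norm_num [norm_smul, heq] at this
  rw [h]
  exact (isCompact_closedBall _ _).inter_right (hD.isClosed.preimage continuous_klein_formula)

theorem isClosed_hypClosedBall (m : HypSpace n) {r : ℝ} (hr : 0 ≤ r) :
    IsClosed (hypClosedBall m r) := by
  have : hypClosedBall m r =
      {x | -⟪toHyperboloid m, toHyperboloid x⟫ ≤ Real.cosh r} := by
    ext x
    exact hypDist_le_iff hr
  rw [this]
  exact isClosed_le ((continuous_lorentzForm_left _).comp continuous_toHyperboloid).neg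
    continuous_const

theorem isCompact_hypClosedBall (m : HypSpace n) {r : ℝ} (hr : 0 ≤ r) :
    IsCompact (hypClosedBall m r) := by
  rw [Subtype.isCompact_iff]
  have h : Subtype.val '' (hypClosedBall m r) = Metric.closedBall 0 1 ∩
      {x : EuclideanSpace ℝ (Fin n) | 2 * ‖m.1 - x‖ ^ 2 ≤
        (Real.cosh r - 1) * ((1 - ‖m.1‖ ^ 2) * (1 - ‖x‖ ^ 2))} := by
    have hm := one_sub_norm_sq_pos m
    have key : ∀ y : HypSpace n, y ∈ hypClosedBall m r ↔ 2 * ‖m.1 - y.1‖ ^ 2 ≤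
        (Real.cosh r - 1) * ((1 - ‖m.1‖ ^ 2) * (1 - ‖y.1‖ ^ 2)) := by
      intro y
      have hy := one_sub_norm_sq_pos y
      rw [← div_le_iff₀ (by positivity), le_sub_iff_add_le', ← neg_lorentzForm_toHyperboloid]
      exact hypDist_le_iff hr
    ext x
    constructor
    · rintro ⟨y, hy, rfl⟩
      exact ⟨Metric.ball_subset_closedBall y.2, (key y).1 hy⟩
    · rintro ⟨hx, hxm⟩
      have hx1 : ‖x‖ ≤ 1 := mem_closedBall_zero_iff.1 hx
      rcases hx1.lt_or_eq with hlt | heq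
      · exact ⟨⟨x, mem_ball_zero_iff.2 hlt⟩, (key ⟨x, mem_ball_zero_iff.2 hlt⟩).2 hxm, rfl⟩
      · simp only [mem_ofPred_eq, heq] at hxm
        have h0 : ‖m.1 - x‖ ^ 2 = 0 := le_antisymm (by linarith) (sq_nonneg _)
        have h1 : m.1 - x = 0 := by simpa using h0
        rw [sub_eq_zero.1 h1, heq] at hm
        norm_num at hm
  rw [h]
  refine (isCompact_closedBall _ _).inter_right (isClosed_le ?_ ?_) <;> fun_prop

theorem hypConvex_hypClosedBall (m : HypSpace n) {r : ℝ} (hr : 0 ≤ r) :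
    HypConvex (hypClosedBall m r) := by
  intro x hx y hy z hz
  have key : ∀ w : HypSpace n, w ∈ hypClosedBall m r ↔
      -⟪toHyperboloid m, toHyperboloid w⟫ ≤ Real.cosh r := fun w => hypDist_le_iff hr
  rw [key] at hx hy ⊢
  obtain ⟨a, b, ha, hb, h⟩ := mem_hypSegment_iff.1 hz
  have h1 := lorentzForm_toHyperboloid_self z
  have h2 := one_le_neg_lorentzForm x y
  rw [h] at h1 ⊢
  simp only [map_add, map_smul, LinearMap.add_apply, LinearMap.smul_apply, smul_eq_mul,
    lorentzForm_toHyperboloid_self, lorentzForm_comm (toHyperboloid y) (toHyperboloid x)] at h1 ⊢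
  -- The normalization of `z` reads `a ^ 2 + b ^ 2 + 2 * a * b * c = 1` with `c ≥ 1`, hence `(a + b)
  -- ^ 2 ≤ 1`.
  have hab : a + b ≤ 1 := by nlinarith [mul_nonneg ha hb]
  have hc := Real.cosh_pos r
  nlinarith [mul_le_mul_of_nonneg_left hx ha, mul_le_mul_of_nonneg_left hy hb]

theorem isCompact_convexHull_insert {E : Type*} [NormedAddCommGroup E] [NormedSpace ℝ E]
    {s : Set E} (hs : IsCompact (convexHull ℝ s)) (hne : s.Nonempty) (x : E) :
    IsCompact (convexHull ℝ (insert x s)) := by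
  have h : convexHull ℝ (insert x s) =
      (fun p : E × ℝ => AffineMap.lineMap x p.1 p.2) '' (convexHull ℝ s ×ˢ Icc (0 : ℝ) 1) := by
    rw [convexHull_insert hne, convexJoin_singleton_left]
    ext y
    simp only [mem_iUnion, segment_eq_image_lineMap, mem_image, Prod.exists, mem_prod]
    constructor
    · rintro ⟨z, hz, t, ht, rfl⟩
      exact ⟨z, t, ⟨hz, ht⟩, rfl⟩
    · rintro ⟨z, t, ⟨hz, ht⟩, rfl⟩
      exact ⟨z, hz, t, ht, rfl⟩
  rw [h]
  refine (hs.prod isCompact_Icc).image ?_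
  simp only [AffineMap.lineMap_apply_module']
  fun_prop

theorem isCompact_hypSpindle (γ : ℝ → HypSpace n) {r : ℝ} (hr : 0 ≤ r) (a : ℝ) :
    IsCompact (hypSpindle γ r a) := by
  rw [hypSpindle, hypConvexHull_eq]
  refine isCompact_preimage_toKlein ?_ fun k hk => ?_
  · have hB : IsCompact (convexHull ℝ (toKlein '' hypClosedBall (γ 0) r)) := by
      rw [(hypConvex_hypClosedBall (γ 0) hr).convex_image_toKlein.convexHull_eq]
      exact (isCompact_hypClosedBall (γ 0) hr).image continuous_toKlein
    have hne : (toKlein '' hypClosedBall (γ 0) r).Nonempty :=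
      ⟨_, mem_image_of_mem _ (show hypDist (γ 0) (γ 0) ≤ r by simpa using hr)⟩
    rw [image_union, image_pair, union_comm, insert_union, singleton_union]
    exact isCompact_convexHull_insert (isCompact_convexHull_insert hB hne _) (insert_nonempty _ _) _
  · rw [← mem_ball_zero_iff]
    refine convexHull_min ?_ (convex_ball _ _) hk
    rintro _ ⟨x, -, rfl⟩
    exact mem_ball_zero_iff.2 (norm_toKlein_lt_one x)

theorem isHypConvexBody_hypSpindle (γ : ℝ → HypSpace n) {r : ℝ} (hr : 0 < r) (a : ℝ) :
    IsHypConvexBody (hypSpindle γ r a) := by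
  refine ⟨isCompact_hypSpindle γ hr.le a, hypConvex_hypConvexHull _, γ 0, ?_⟩
  rw [mem_interior]
  refine ⟨{x | -⟪toHyperboloid (γ 0), toHyperboloid x⟫ < Real.cosh r}, ?_, ?_, ?_⟩
  · intro x hx
    exact subset_hypConvexHull _ (Or.inl ((hypDist_le_iff hr.le).2 (le_of_lt hx)))
  · exact isOpen_lt ((continuous_lorentzForm_left _).comp continuous_toHyperboloid).neg
      continuous_const
  · simpa using Real.one_lt_cosh.2 hr.ne'

end KleinModel

/-! ### Half-spaces as linear inequalities on the hyperboloid; existence of supporting hyperplanes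
-/

section HalfSpaces

variable {n : ℕ}

local notation "⟪" X ", " Y "⟫" => lorentzForm (EuclideanSpace ℝ (Fin n)) X Y

theorem norm_sub_le_iff {x p : EuclideanSpace ℝ (Fin n)} {ρ : ℝ} (hρ : 0 < ρ)
    (hp : ‖p‖ ^ 2 = 1 + ρ ^ 2) :
    (‖x - p‖ ≤ ρ ↔ 1 + ‖x‖ ^ 2 ≤ 2 * inner ℝ p x) ∧
    (ρ ≤ ‖x - p‖ ↔ 2 * inner ℝ p x ≤ 1 + ‖x‖ ^ 2) := by
  have h := norm_sub_sq_real x p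
  rw [hp, real_inner_comm] at h
  rw [← sq_le_sq₀ (norm_nonneg _) hρ.le, ← sq_le_sq₀ hρ.le (norm_nonneg _), h]
  constructor <;> constructor <;> intro _ <;> linarith

/-- For a sphere, orthogonality `‖p‖ ^ 2 = 1 + ρ ^ 2` makes `±(1, p) / ρ` a unit spacelike normal,
with the sign selecting the side. -/
theorem IsHypHalfSpace.exists_normal {S H : Set (HypSpace n)} (h : IsHypHalfSpace S H) :
    ∃ N : ℝ × EuclideanSpace ℝ (Fin n), ⟪N, N⟫ = 1 ∧
      H = {x | ⟪N, toHyperboloid x⟫ = 0} ∧ S = {x | 0 ≤ ⟪N, toHyperboloid x⟫} := by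
  rcases h with ⟨u, hu, rfl, rfl⟩ | ⟨p, ρ, hρ, hp, rfl, hS⟩
  · have hu0 : 0 < ‖u‖ := norm_pos_iff.2 hu
    refine ⟨(0, ‖u‖⁻¹ • u), ?_, ?_, ?_⟩
    · rw [lorentzForm_apply, real_inner_self_eq_norm_sq]
      simp [norm_smul, hu0.ne']
    all_goals
      ext x
      have hx := one_sub_norm_sq_pos x
      simp only [mem_ofPred_eq, lorentzForm_toHyperboloid, inner_smul_left, conj_trivial, zero_mul,
        sub_zero]
    · simp [hx.ne', hu]
    · rw [le_div_iff₀ hx, zero_mul, mul_nonneg_iff_of_pos_left two_pos,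
        mul_nonneg_iff_of_pos_left (inv_pos.2 hu0)]
  · have hsgn : ∀ s : ℝ, s ^ 2 = 1 → ⟪((s / ρ, (s / ρ) • p) : ℝ × EuclideanSpace ℝ (Fin n)),
        (s / ρ, (s / ρ) • p)⟫ = 1 := by
      intro s hs
      rw [lorentzForm_apply, real_inner_self_eq_norm_sq]
      simp only [norm_smul, mul_pow, Real.norm_eq_abs, sq_abs, div_pow, hs, hp]
      rw [← sq, div_pow, hs]
      field_simp
      ring
    have hval : ∀ (s : ℝ) (x : HypSpace n), ⟪(s / ρ, (s / ρ) • p), toHyperboloid x⟫ =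
        (ρ * (1 - ‖x.1‖ ^ 2))⁻¹ * (s * (2 * inner ℝ p x.1 - (1 + ‖x.1‖ ^ 2))) := by
      intro s x
      have hx := one_sub_norm_sq_pos x
      rw [lorentzForm_toHyperboloid]
      simp only [inner_smul_left, conj_trivial]
      field_simp
    have hpos : ∀ x : HypSpace n, 0 < (ρ * (1 - ‖x.1‖ ^ 2))⁻¹ := fun x =>
      inv_pos.2 (mul_pos hρ (one_sub_norm_sq_pos x))
    have hH : ∀ s : ℝ, s ^ 2 = 1 → {x : HypSpace n | ‖x.1 - p‖ = ρ} =
        {x | ⟪(s / ρ, (s / ρ) • p), toHyperboloid x⟫ = 0} := by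
      intro s hs
      have hs0 : s ≠ 0 := by rintro rfl; norm_num at hs
      ext x
      simp only [mem_ofPred_eq, hval, mul_eq_zero, (hpos x).ne', hs0, false_or]
      rw [le_antisymm_iff, (norm_sub_le_iff hρ hp).1, (norm_sub_le_iff hρ hp).2, sub_eq_zero,
        and_comm, ← le_antisymm_iff]
    rcases hS with rfl | rfl
    · refine ⟨_, hsgn 1 (by norm_num), hH 1 (by norm_num), ?_⟩
      ext x
      simp only [mem_ofPred_eq, hval, mul_nonneg_iff_of_pos_left (hpos x),
        (norm_sub_le_iff hρ hp).1]
      constructor <;> intro _ <;> linarith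
    · refine ⟨_, hsgn (-1) (by norm_num), hH (-1) (by norm_num), ?_⟩
      ext x
      simp only [mem_ofPred_eq, hval, mul_nonneg_iff_of_pos_left (hpos x),
        (norm_sub_le_iff hρ hp).2]
      constructor <;> intro _ <;> linarith

theorem isHypHalfSpace_of_normal {N : ℝ × EuclideanSpace ℝ (Fin n)} (hN : 0 < ⟪N, N⟫) :
    IsHypHalfSpace {x : HypSpace n | 0 ≤ ⟪N, toHyperboloid x⟫}
      {x | ⟪N, toHyperboloid x⟫ = 0} := by
  obtain ⟨a, v⟩ := N
  rw [lorentzForm_apply, real_inner_self_eq_norm_sq] at hN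
  simp only at hN
  by_cases ha : a = 0
  · subst ha
    left
    refine ⟨v, ?_, ?_, ?_⟩
    · rintro rfl
      simp at hN
    all_goals
      ext x
      have hx := one_sub_norm_sq_pos x
      simp only [mem_ofPred_eq, lorentzForm_toHyperboloid, zero_mul, sub_zero]
    · simp [hx.ne']
    · rw [le_div_iff₀ hx, zero_mul, mul_nonneg_iff_of_pos_left two_pos]
  · right
    have ha2 : 0 < a ^ 2 := by positivity
    have hρ : 0 < ‖v‖ ^ 2 / a ^ 2 - 1 := by
      rw [sub_pos, lt_div_iff₀ ha2]
      linarith [sq a]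
    have hp : ‖a⁻¹ • v‖ ^ 2 = 1 + √(‖v‖ ^ 2 / a ^ 2 - 1) ^ 2 := by
      rw [Real.sq_sqrt hρ.le, norm_smul, mul_pow, Real.norm_eq_abs, sq_abs]
      field_simp
      ring
    have hin : ∀ x : HypSpace n, 2 * inner ℝ (a⁻¹ • v) x.1 - (1 + ‖x.1‖ ^ 2) =
        ((1 - ‖x.1‖ ^ 2) / a) * ⟪(a, v), toHyperboloid x⟫ := by
      intro x
      have hx := one_sub_norm_sq_pos x
      rw [lorentzForm_toHyperboloid, inner_smul_left, conj_trivial]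
      field_simp
    refine ⟨a⁻¹ • v, _, Real.sqrt_pos.2 hρ, hp, ?_, ?_⟩
    · ext x
      have hx := one_sub_norm_sq_pos x
      simp only [mem_ofPred_eq]
      rw [le_antisymm_iff (a := ‖_‖), (norm_sub_le_iff (Real.sqrt_pos.2 hρ) hp).1,
        (norm_sub_le_iff (Real.sqrt_pos.2 hρ) hp).2, and_comm, ← le_antisymm_iff,
        ← sub_eq_zero (a := 2 * _), hin]
      simp [ha, hx.ne']
    · rcases lt_or_gt_of_ne ha with h0 | h0
      · right
        ext x
        have hx : (1 - ‖x.1‖ ^ 2) / a < 0 := div_neg_of_pos_of_neg (one_sub_norm_sq_pos x) h0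
        have h1 := hin x
        simp only [mem_ofPred_eq]
        rw [(norm_sub_le_iff (Real.sqrt_pos.2 hρ) hp).2, ← sub_nonpos (a := 2 * _), hin]
        constructor <;> intro h <;> nlinarith
      · left
        ext x
        have hx : 0 < (1 - ‖x.1‖ ^ 2) / a := div_pos (one_sub_norm_sq_pos x) h0
        simp only [mem_ofPred_eq]
        rw [(norm_sub_le_iff (Real.sqrt_pos.2 hρ) hp).1, ← sub_nonneg (b := 1 + _), hin,
          mul_nonneg_iff_of_pos_left hx]

/-- A linear functional in Klein coordinates attains its maximum on `K`, and its level set there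
supports `K`. This is needed because the real infimum over an empty family is `0`, which would spoil
lower bounds on the width. -/
theorem exists_isHypSupportingHyperplane (hn : 0 < n) {K : Set (HypSpace n)} (hK : IsCompact K)
    (hne : K.Nonempty) : ∃ H, IsHypSupportingHyperplane K H := by
  set e : EuclideanSpace ℝ (Fin n) := EuclideanSpace.single ⟨0, hn⟩ 1 with he
  have he1 : ‖e‖ = 1 := by simp [he]
  have hcont : Continuous fun x : HypSpace n => inner ℝ e (toKlein x) :=
    continuous_const.inner continuous_toKlein
  obtain ⟨x₀, hx₀, hmax⟩ := hK.exists_isMaxOn hne hcont.continuousOn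
  set c := inner ℝ e (toKlein x₀) with hc
  have hc1 : c ^ 2 < 1 := by
    have h1 := abs_real_inner_le_norm e (toKlein x₀)
    rw [he1, one_mul] at h1
    rw [sq_lt_one_iff_abs_lt_one]
    exact h1.trans_lt (norm_toKlein_lt_one x₀)
  have hval : ∀ x : HypSpace n, ⟪(-c, -e), toHyperboloid x⟫ =
      (toHyperboloid x).1 * (c - inner ℝ e (toKlein x)) := by
    intro x
    rw [lorentzForm_apply, toHyperboloid_snd]
    simp only [inner_neg_left, inner_smul_right]
    ring
  refine ⟨{x | ⟪(-c, -e), toHyperboloid x⟫ = 0}, ⟨_, isHypHalfSpace_of_normal ?_, ?_⟩, x₀, hx₀, ?_⟩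
  · rw [lorentzForm_apply, real_inner_self_eq_norm_sq]
    simp only [norm_neg, he1]
    nlinarith
  · intro x hx
    rw [mem_ofPred_eq, hval]
    exact mul_nonneg (toHyperboloid_fst_pos x).le (sub_nonneg.2 (hmax hx))
  · rw [mem_ofPred_eq, hval, ← hc, sub_self, mul_zero]

end HalfSpaces

/-! ### Lower bound for the minimal Lassak width -/

section Width

variable {n : ℕ}

local notation "⟪" X ", " Y "⟫" => lorentzForm (EuclideanSpace ℝ (Fin n)) X Y

theorem hypInfDist_le {x y : HypSpace n} {H : Set (HypSpace n)} (hy : y ∈ H) :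
    hypInfDist x H ≤ hypDist x y :=
  csInf_le ⟨0, by rintro _ ⟨z, -, rfl⟩; exact hypDist_nonneg x z⟩ (mem_image_of_mem _ hy)

theorem hypInfDist_le_lassakWidthAt {K H : Set (HypSpace n)} (hK : IsCompact K)
    (hH : H.Nonempty) {x : HypSpace n} (hx : x ∈ K) : hypInfDist x H ≤ lassakWidthAt K H := by
  refine le_csSup ?_ (mem_image_of_mem _ hx)
  obtain ⟨y, hy⟩ := hH
  have hcont : Continuous fun x : HypSpace n => -⟪toHyperboloid y, toHyperboloid x⟫ :=
    ((continuous_lorentzForm_left _).comp continuous_toHyperboloid).neg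
  obtain ⟨B, hB⟩ := hK.bddAbove_image hcont.continuousOn
  refine ⟨B, ?_⟩
  rintro _ ⟨z, hz, rfl⟩
  refine (hypInfDist_le hy).trans (le_trans ?_ (hB (mem_image_of_mem _ hz)))
  rw [hypDist_comm]
  simp only [← cosh_hypDist]
  exact (Real.self_le_sinh_iff.2 (hypDist_nonneg _ _)).trans (Real.sinh_lt_cosh _).le

theorem le_hypInfDist {N : ℝ × EuclideanSpace ℝ (Fin n)} (hN : ⟪N, N⟫ = 1) {x : HypSpace n} {w : ℝ}
    (hne : {y | ⟪N, toHyperboloid y⟫ = 0}.Nonempty) (hw : Real.sinh w ≤ ⟪N, toHyperboloid x⟫) :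
    w ≤ hypInfDist x {y | ⟪N, toHyperboloid y⟫ = 0} := by
  refine le_csInf (hne.image _) ?_
  rintro _ ⟨y, hy, rfl⟩
  rw [← Real.sinh_le_sinh]
  exact hw.trans ((le_abs_self _).trans (abs_lorentzForm_le_sinh_hypDist hN hy))

/-- The hyperboloid parametrization of a geodesic line. -/
theorem IsHypLine.exists_direction {γ : ℝ → HypSpace n} (hγ : IsHypLine γ) :
    ∃ U : ℝ × EuclideanSpace ℝ (Fin n), ⟪U, toHyperboloid (γ 0)⟫ = 0 ∧ ⟪U, U⟫ = 1 ∧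
      ∀ t, toHyperboloid (γ t) = Real.cosh t • toHyperboloid (γ 0) + Real.sinh t • U := by
  have hd : ∀ s t, ⟪toHyperboloid (γ s), toHyperboloid (γ t)⟫ = -Real.cosh (s - t) := by
    intro s t
    rw [lorentzForm_eq_neg_cosh, hγ, Real.cosh_abs]
  have hs : 0 < Real.sinh 1 := Real.sinh_pos_iff.2 one_pos
  have hc := Real.cosh_sq 1
  set U := (Real.sinh 1)⁻¹ • (toHyperboloid (γ 1) - Real.cosh 1 • toHyperboloid (γ 0)) with hU
  have hU0 : ⟪U, toHyperboloid (γ 0)⟫ = 0 := by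
    simp [hU, hd]
  have hUU : ⟪U, U⟫ = 1 := by
    simp only [hU, map_sub, map_smul, LinearMap.sub_apply, LinearMap.smul_apply, smul_eq_mul, hd]
    simp only [sub_self, Real.cosh_zero, sub_zero, zero_sub, Real.cosh_neg]
    field_simp
    linarith
  have hUt : ∀ t, ⟪U, toHyperboloid (γ t)⟫ = Real.sinh t := by
    intro t
    simp only [hU, map_sub, map_smul, LinearMap.sub_apply, LinearMap.smul_apply, smul_eq_mul, hd]
    simp only [Real.cosh_sub, zero_sub, Real.cosh_neg]
    field_simp
    ring
  refine ⟨U, hU0, hUU, fun t => ?_⟩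
  have hct := Real.cosh_sq t
  have h0U := lorentzForm_comm (toHyperboloid (γ 0)) U
  have htU := lorentzForm_comm (toHyperboloid (γ t)) U
  rw [← sub_eq_zero, sub_add_eq_sub_sub]
  refine eq_zero_of_lorentzForm_self (lorentzForm_toHyperboloid_self (γ 0)) ?_ ?_
  · simp [hd, hU0]
  · simp only [map_sub, map_smul, LinearMap.sub_apply, LinearMap.smul_apply, smul_eq_mul, hd, hUt,
      hUU, h0U, htU]
    simp only [sub_self, Real.cosh_zero, Real.sinh_zero, sub_zero, zero_sub, Real.cosh_neg]
    linarith

theorem le_minLassakWidth_of_line (hn : 0 < n) {γ : ℝ → HypSpace n} (hγ : IsHypLine γ)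
    {K : Set (HypSpace n)} (hK : IsCompact K) {r a w : ℝ} (hr : 0 ≤ r)
    (hball : hypClosedBall (γ 0) r ⊆ K) (hp : γ (-a) ∈ K) (hq : γ a ∈ K)
    (hw : Real.sinh w ≤ Real.sinh r * Real.cosh a) : w ≤ minLassakWidth K := by
  obtain ⟨H₀, hH₀⟩ := exists_isHypSupportingHyperplane hn hK ⟨_, hq⟩
  refine le_csInf ⟨_, mem_image_of_mem _ hH₀⟩ ?_
  rintro _ ⟨H, ⟨⟨S, hS, hKS⟩, y, hyK, hyH⟩, rfl⟩
  obtain ⟨N, hN, rfl, rfl⟩ := hS.exists_normal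
  have hm : Real.sinh r ≤ ⟪N, toHyperboloid (γ 0)⟫ :=
    sinh_le_lorentzForm_of_closedBall_subset hN hr fun x hx => hKS (hball hx)
  obtain ⟨U, -, -, hU⟩ := hγ.exists_direction
  have h1 := hU a
  have h2 := hU (-a)
  rw [Real.cosh_neg, Real.sinh_neg] at h2
  -- The `sinh` components along `U` cancel, so the tilt of the hyperplane relative to the line does
  -- not matter.
  have hsum : ⟪N, toHyperboloid (γ a)⟫ + ⟪N, toHyperboloid (γ (-a))⟫ =
      2 * (Real.cosh a * ⟪N, toHyperboloid (γ 0)⟫) := by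
    rw [h1, h2]
    simp only [map_add, map_smul, smul_eq_mul]
    ring
  have hle : Real.sinh w ≤ Real.cosh a * ⟪N, toHyperboloid (γ 0)⟫ := by
    refine hw.trans ?_
    rw [mul_comm]
    exact mul_le_mul_of_nonneg_left hm (Real.cosh_pos a).le
  rcases le_total (Real.sinh w) ⟪N, toHyperboloid (γ a)⟫ with h | h
  · exact (le_hypInfDist hN ⟨y, hyH⟩ h).trans (hypInfDist_le_lassakWidthAt hK ⟨y, hyH⟩ hq)
  · exact (le_hypInfDist hN ⟨y, hyH⟩ (by linarith)).trans
      (hypInfDist_le_lassakWidthAt hK ⟨y, hyH⟩ hp)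

end Width

/-! ### Convex cusp neighborhood of the line and its cover by shrinking balls -/

section Neighborhood

variable {n : ℕ}

local notation "⟪" X ", " Y "⟫" => lorentzForm (EuclideanSpace ℝ (Fin n)) X Y

theorem Real.cosh_sub_abs_sinh (t : ℝ) : Real.cosh t - |Real.sinh t| = Real.exp (-|t|) := by
  rcases le_total 0 t with h | h
  · rw [abs_of_nonneg h, abs_of_nonneg (Real.sinh_nonneg_iff.2 h), Real.cosh_sub_sinh]
  · rw [abs_of_nonpos h, abs_of_nonpos (Real.sinh_nonpos_iff.2 h), sub_neg_eq_add, neg_neg,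
      Real.cosh_add_sinh]

/-- The component of `X` orthogonal to the plane spanned by the orthonormal pair `M`, `U`. -/
noncomputable def planeNormal (M U X : ℝ × EuclideanSpace ℝ (Fin n)) :
    ℝ × EuclideanSpace ℝ (Fin n) :=
  X + ⟪X, M⟫ • M - ⟪X, U⟫ • U

theorem lorentzForm_planeNormal_left {M U : ℝ × EuclideanSpace ℝ (Fin n)} (hM : ⟪M, M⟫ = -1)
    (hUM : ⟪U, M⟫ = 0) (X : ℝ × EuclideanSpace ℝ (Fin n)) : ⟪planeNormal M U X, M⟫ = 0 := by
  simp [planeNormal, hM, hUM]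

theorem lorentzForm_planeNormal_self {M U : ℝ × EuclideanSpace ℝ (Fin n)} (hM : ⟪M, M⟫ = -1)
    (hUM : ⟪U, M⟫ = 0) (hU : ⟪U, U⟫ = 1) (X : ℝ × EuclideanSpace ℝ (Fin n)) :
    ⟪planeNormal M U X, planeNormal M U X⟫ = ⟪X, X⟫ + ⟪X, M⟫ ^ 2 - ⟪X, U⟫ ^ 2 := by
  simp only [planeNormal, map_add, map_sub, map_smul, LinearMap.add_apply, LinearMap.sub_apply,
    LinearMap.smul_apply, smul_eq_mul, hM, hU, hUM, lorentzForm_comm M U, lorentzForm_comm M X,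
    lorentzForm_comm U X]
  ring

/-- A convex neighborhood of a geodesic line that narrows towards its two ends. -/
def cuspNeighborhood (M U : ℝ × EuclideanSpace ℝ (Fin n)) (ε : ℝ) : Set (HypSpace n) :=
  {x | √⟪planeNormal M U (toHyperboloid x), planeNormal M U (toHyperboloid x)⟫ ≤
    ε * (-⟪toHyperboloid x, M⟫ - |⟪toHyperboloid x, U⟫|)}

/-- The left side of the defining inequality is a seminorm, the right side is concave and
homogeneous of degree one, so nonnegative combinations preserve it. -/
theorem hypConvex_cuspNeighborhood {M U : ℝ × EuclideanSpace ℝ (Fin n)} (hM : ⟪M, M⟫ = -1)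
    (hUM : ⟪U, M⟫ = 0) {ε : ℝ} (hε : 0 ≤ ε) : HypConvex (cuspNeighborhood M U ε) := by
  intro x hx y hy z hz
  obtain ⟨a, b, ha, hb, h⟩ := mem_hypSegment_iff.1 hz
  simp only [cuspNeighborhood, mem_ofPred_eq] at hx hy ⊢
  have hlin : planeNormal M U (toHyperboloid z) =
      a • planeNormal M U (toHyperboloid x) + b • planeNormal M U (toHyperboloid y) := by
    rw [h]
    simp only [planeNormal, map_add, map_smul, LinearMap.add_apply, LinearMap.smul_apply,
      smul_eq_mul]
    module
  have h1 := lorentzForm_planeNormal_left hM hUM (toHyperboloid x)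
  have h2 := lorentzForm_planeNormal_left hM hUM (toHyperboloid y)
  have h3 := sqrt_lorentzForm_add_le hM
    (V := a • planeNormal M U (toHyperboloid x)) (W := b • planeNormal M U (toHyperboloid y))
    (by simp [h1]) (by simp [h2])
  rw [sqrt_lorentzForm_smul ha, sqrt_lorentzForm_smul hb] at h3
  rw [hlin]
  refine h3.trans ((add_le_add (mul_le_mul_of_nonneg_left hx ha)
    (mul_le_mul_of_nonneg_left hy hb)).trans ?_)
  rw [h]
  simp only [map_add, map_smul, LinearMap.add_apply, LinearMap.smul_apply, smul_eq_mul]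
  have h4 := abs_add_le (a * ⟪toHyperboloid x, U⟫) (b * ⟪toHyperboloid y, U⟫)
  rw [abs_mul, abs_mul, abs_of_nonneg ha, abs_of_nonneg hb] at h4
  nlinarith [mul_le_mul_of_nonneg_left h4 hε]

theorem IsHypLine.mem_cuspNeighborhood {γ : ℝ → HypSpace n}
    {U : ℝ × EuclideanSpace ℝ (Fin n)} (hUM : ⟪U, toHyperboloid (γ 0)⟫ = 0) (hUU : ⟪U, U⟫ = 1)
    (hU : ∀ t, toHyperboloid (γ t) = Real.cosh t • toHyperboloid (γ 0) + Real.sinh t • U)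
    {ε : ℝ} (hε : 0 ≤ ε) (t : ℝ) : γ t ∈ cuspNeighborhood (toHyperboloid (γ 0)) U ε := by
  have hM := lorentzForm_toHyperboloid_self (γ 0)
  have h1 : ⟪toHyperboloid (γ t), toHyperboloid (γ 0)⟫ = -Real.cosh t := by
    rw [hU t]; simp [hUM]
  have h2 : ⟪toHyperboloid (γ t), U⟫ = Real.sinh t := by
    rw [hU t]; simp [hUU, lorentzForm_comm _ U, hUM]
  simp only [cuspNeighborhood, mem_ofPred_eq]
  rw [lorentzForm_planeNormal_self hM hUM hUU, h1, h2, lorentzForm_toHyperboloid_self, neg_neg,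
    Real.cosh_sub_abs_sinh, neg_sq, Real.cosh_sq]
  ring_nf
  rw [Real.sqrt_zero]
  positivity

theorem hypClosedBall_subset_cuspNeighborhood {m : HypSpace n}
    {U : ℝ × EuclideanSpace ℝ (Fin n)} (hUM : ⟪U, toHyperboloid m⟫ = 0) (hUU : ⟪U, U⟫ = 1)
    {r : ℝ} (hr : r ≤ 1 / 2) :
    hypClosedBall m r ⊆ cuspNeighborhood (toHyperboloid m) U (2 * r) := by
  intro x hx
  have hM := lorentzForm_toHyperboloid_self m
  change hypDist m x ≤ r at hx
  have hd0 := hypDist_nonneg m x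
  have h1 : ⟪toHyperboloid x, toHyperboloid m⟫ = -Real.cosh (hypDist m x) := by
    rw [lorentzForm_comm, lorentzForm_eq_neg_cosh]
  have hq := lorentzForm_self_nonneg hM (lorentzForm_planeNormal_left hM hUM (toHyperboloid x))
  simp only [cuspNeighborhood, mem_ofPred_eq]
  rw [lorentzForm_planeNormal_self hM hUM hUU, h1, lorentzForm_toHyperboloid_self, neg_sq] at hq ⊢
  rw [neg_neg]
  set d := hypDist m x
  set S := ⟪toHyperboloid x, U⟫
  have hc := Real.cosh_sq d
  have hsd := Real.sinh_nonneg_iff.2 hd0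
  have hS : |S| ≤ Real.sinh d := abs_le_of_sq_le_sq (by linarith) hsd
  have hs1 : √(-1 + Real.cosh d ^ 2 - S ^ 2) ≤ Real.sinh d := by
    rw [Real.sqrt_le_left hsd]
    nlinarith [sq_nonneg S]
  have hsr : Real.sinh d ≤ Real.sinh r := Real.sinh_le_sinh.2 hx
  have hexp : Real.exp (-r) ≤ Real.exp (-d) := Real.exp_le_exp.2 (by linarith)
  have hcs : Real.cosh d - Real.sinh d = Real.exp (-d) := Real.cosh_sub_sinh d
  have hr0 : 0 ≤ r := hd0.trans hx
  -- Equivalent to `exp (2 * r) - 1 ≤ 4 * r`, which holds for `2 * r ≤ 1`; this is where the factor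
  -- 2 in `ε = 2 * r` comes from.
  have hmain : Real.sinh r ≤ 2 * r * Real.exp (-r) := by
    have h2 := Real.abs_exp_sub_one_le (x := 2 * r) (by rw [abs_of_nonneg] <;> linarith)
    rw [abs_of_nonneg (a := 2 * r) (by linarith)] at h2
    have h3 := (le_abs_self _).trans h2
    have h4 : Real.exp (2 * r) * Real.exp (-r) = Real.exp r := by
      rw [← Real.exp_add]; ring_nf
    have h5 := mul_le_mul_of_nonneg_right h3 (Real.exp_pos (-r)).le
    rw [sub_mul, h4] at h5
    rw [Real.sinh_eq]
    linarith
  refine hs1.trans (hsr.trans (hmain.trans (mul_le_mul_of_nonneg_left ?_ (by linarith))))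
  linarith

/-- Take the foot `γ t` of the perpendicular from `x`. With `R` the cosh of the distance to it, the
defining inequality becomes `sinh ≤ ε * R * exp (-|t|)`, and `ε ≤ 1 / 2` forces `R ≤ 2`. -/
theorem IsHypLine.exists_hypDist_le_of_mem_cuspNeighborhood {γ : ℝ → HypSpace n}
    {U : ℝ × EuclideanSpace ℝ (Fin n)} (hUM : ⟪U, toHyperboloid (γ 0)⟫ = 0) (hUU : ⟪U, U⟫ = 1)
    (hU : ∀ t, toHyperboloid (γ t) = Real.cosh t • toHyperboloid (γ 0) + Real.sinh t • U)
    {ε : ℝ} (hε : 0 ≤ ε) (hε1 : ε ≤ 1 / 2) {x : HypSpace n}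
    (hx : x ∈ cuspNeighborhood (toHyperboloid (γ 0)) U ε) :
    ∃ t, hypDist x (γ t) ≤ 2 * ε * Real.exp (-|t|) := by
  have hM := lorentzForm_toHyperboloid_self (γ 0)
  have hq := lorentzForm_self_nonneg hM (lorentzForm_planeNormal_left hM hUM (toHyperboloid x))
  simp only [cuspNeighborhood, mem_ofPred_eq] at hx
  rw [lorentzForm_planeNormal_self hM hUM hUU, lorentzForm_toHyperboloid_self] at hq hx
  have hT0 := one_le_neg_lorentzForm x (γ 0)
  have hxt : ∀ t, ⟪toHyperboloid x, toHyperboloid (γ t)⟫ =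
      Real.cosh t * ⟪toHyperboloid x, toHyperboloid (γ 0)⟫ +
        Real.sinh t * ⟪toHyperboloid x, U⟫ := by
    intro t
    rw [hU t]
    simp
  obtain ⟨T, hT⟩ : ∃ T, T = -⟪toHyperboloid x, toHyperboloid (γ 0)⟫ := ⟨_, rfl⟩
  have hT' : ⟪toHyperboloid x, toHyperboloid (γ 0)⟫ = -T := by rw [hT, neg_neg]
  rw [hT'] at hq hx hT0
  rw [neg_neg] at hx hT0
  set S := ⟪toHyperboloid x, U⟫
  set R := √(T ^ 2 - S ^ 2) with hR
  have hR1 : 0 < T ^ 2 - S ^ 2 := by nlinarith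
  have hR0 : 0 < R := Real.sqrt_pos.2 hR1
  have hRR : R ^ 2 = T ^ 2 - S ^ 2 := Real.sq_sqrt hR1.le
  set t := Real.arsinh (S / R) with ht
  have hst : Real.sinh t = S / R := Real.sinh_arsinh _
  have hct : Real.cosh t = T / R := by
    rw [← sq_eq_sq₀ (Real.cosh_pos t).le (by positivity), Real.cosh_sq, hst, div_pow, div_pow]
    field_simp
    linarith
  have hcosh : Real.cosh (hypDist x (γ t)) = R := by
    rw [cosh_hypDist, hxt, hct, hst, hT']
    field_simp
    linarith
  have hexp : T - |S| = R * Real.exp (-|t|) := by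
    rw [← Real.cosh_sub_abs_sinh, hct, hst, abs_div, abs_of_pos hR0]
    field_simp
  have hsinh : Real.sinh (hypDist x (γ t)) = √(-1 + (-T) ^ 2 - S ^ 2) := by
    rw [eq_comm, Real.sqrt_eq_iff_mul_self_eq hq (Real.sinh_nonneg_iff.2 (hypDist_nonneg _ _)),
      ← sq, Real.sinh_sq, hcosh, hRR]
    ring
  have he1 : Real.exp (-|t|) ≤ 1 := Real.exp_le_one_iff.2 (by simp)
  have he0 := Real.exp_pos (-|t|)
  rw [hexp, ← hsinh] at hx
  have hs0 := Real.sinh_nonneg_iff.2 (hypDist_nonneg x (γ t))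
  have hR2 : R ≤ 2 := by
    have h1 : Real.sinh (hypDist x (γ t)) ≤ 1 / 2 * R := by
      refine hx.trans (mul_le_mul hε1 ?_ (by positivity) (by norm_num))
      nlinarith
    have h2 := Real.cosh_sq (hypDist x (γ t))
    rw [hcosh] at h2
    nlinarith
  refine ⟨t, (Real.self_le_sinh_iff.2 (hypDist_nonneg _ _)).trans (hx.trans ?_)⟩
  have : R * Real.exp (-|t|) ≤ 2 * Real.exp (-|t|) := mul_le_mul_of_nonneg_right hR2 he0.le
  nlinarith [mul_le_mul_of_nonneg_left this hε]

/-- The points `± log (1 + r i)` are `r e^{-|t|}`-dense. -/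
theorem exists_nat_log_near {r : ℝ} (hr : 0 < r) (t : ℝ) : ∃ i : ℕ,
    Real.exp (-|t|) ≤ 1 / (1 + r * i) ∧
    (|t - Real.log (1 + r * i)| ≤ r / (1 + r * i) ∨
      |t - -Real.log (1 + r * i)| ≤ r / (1 + r * i)) := by
  have he : 1 ≤ Real.exp |t| := Real.one_le_exp (abs_nonneg t)
  have h0 : 0 ≤ (Real.exp |t| - 1) / r := div_nonneg (by linarith) hr.le
  -- This gives `1 + r * i ≤ exp |t| < 1 + r * (i + 1)`, and consecutive logarithms differ by at
  -- most `r / (1 + r * i)`.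
  set i := ⌊(Real.exp |t| - 1) / r⌋₊ with hi
  have h1 : (i : ℝ) ≤ (Real.exp |t| - 1) / r := Nat.floor_le h0
  have h2 : (Real.exp |t| - 1) / r < i + 1 := Nat.lt_floor_add_one _
  rw [le_div_iff₀ hr] at h1
  rw [div_lt_iff₀ hr] at h2
  have hp : 0 < 1 + r * i := by positivity
  have h3 : Real.log (1 + r * i) ≤ |t| := by
    rw [Real.log_le_iff_le_exp hp]
    linarith
  have h4 : |t| - Real.log (1 + r * i) ≤ r / (1 + r * i) := by
    have h5 : Real.exp (|t| - Real.log (1 + r * i)) ≤ Real.exp (r / (1 + r * i)) := by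
      rw [Real.exp_sub, Real.exp_log hp]
      refine le_trans ?_ (Real.add_one_le_exp _)
      rw [div_le_iff₀ hp, add_mul, div_mul_cancel₀ _ hp.ne']
      linarith
    exact Real.exp_le_exp.1 h5
  refine ⟨i, ?_, ?_⟩
  · rw [Real.exp_neg, ← one_div]
    exact one_div_le_one_div_of_le hp (by linarith)
  · rcases le_total 0 t with h | h
    · left
      rw [abs_of_nonneg h] at h3 h4
      rwa [abs_of_nonneg (by linarith)]
    · right
      rw [abs_of_nonpos h] at h3 h4
      rw [abs_of_nonpos (by linarith)]
      linarith

/-- The cover does not depend on `a`. The constant 5 is 4 for the distance to the line plus 1 for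
the shift along it to a center. -/
theorem IsHypLine.hypSpindle_subset_iUnion {γ : ℝ → HypSpace n} (hγ : IsHypLine γ) {r : ℝ}
    (hr : 0 < r) (hr1 : r ≤ 1 / 4) (a : ℝ) :
    hypSpindle γ r a ⊆ ⋃ i : ℕ,
      hypClosedBall (γ (Real.log (1 + r * i))) (5 * r / (1 + r * i)) ∪
        hypClosedBall (γ (-Real.log (1 + r * i))) (5 * r / (1 + r * i)) := by
  obtain ⟨U, hUM, hUU, hU⟩ := hγ.exists_direction
  have hsub : hypSpindle γ r a ⊆ cuspNeighborhood (toHyperboloid (γ 0)) U (2 * r) := by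
    refine hypConvexHull_subset (hypConvex_cuspNeighborhood (lorentzForm_toHyperboloid_self _) hUM
      (by linarith)) (union_subset (hypClosedBall_subset_cuspNeighborhood hUM hUU (by linarith)) ?_)
    rintro x (rfl | rfl) <;> exact IsHypLine.mem_cuspNeighborhood hUM hUU hU (by linarith) _
  intro x hx
  obtain ⟨t, ht⟩ := IsHypLine.exists_hypDist_le_of_mem_cuspNeighborhood hUM hUU hU (by linarith)
    (by linarith) (hsub hx)
  obtain ⟨i, hi, hlog⟩ := exists_nat_log_near hr t
  have hp : 0 < 1 + r * i := by positivity
  have key : ∀ s : ℝ, |t - s| ≤ r / (1 + r * i) →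
      x ∈ hypClosedBall (γ s) (5 * r / (1 + r * i)) := by
    intro s hs
    change hypDist (γ s) x ≤ _
    rw [hypDist_comm]
    refine (hypDist_triangle x (γ t) (γ s)).trans ?_
    rw [hγ t s]
    have h1 : 2 * (2 * r) * Real.exp (-|t|) ≤ 2 * (2 * r) * (1 / (1 + r * i)) :=
      mul_le_mul_of_nonneg_left hi (by linarith)
    have h2 : 5 * r / (1 + r * i) = 2 * (2 * r) * (1 / (1 + r * i)) + r / (1 + r * i) := by ring
    rw [h2]
    exact add_le_add (ht.trans h1) hs
  exact mem_iUnion.2 ⟨i, hlog.imp (key _) (key _)⟩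

end Neighborhood

/-! ### Volume estimates -/

section Volume

variable {n : ℕ}

theorem norm_sub_le_of_hypDist_le {c x : HypSpace n} {ρ : ℝ} (hρ : 0 ≤ ρ) (hρ1 : ρ ≤ 1)
    (h : hypDist c x ≤ ρ) : ‖c.1 - x.1‖ ≤ 2 * ρ * (1 - ‖c.1‖ ^ 2) ∧
      1 - ‖c.1‖ ^ 2 ≤ 4 * (1 - ‖x.1‖ ^ 2) := by
  have ha := one_sub_norm_sq_pos c
  have hb := one_sub_norm_sq_pos x
  rw [hypDist_le_iff hρ, neg_lorentzForm_toHyperboloid, ← le_sub_iff_add_le',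
    div_le_iff₀ (by positivity)] at h
  have hcosh : Real.cosh ρ - 1 ≤ ρ ^ 2 := by
    have h1 := Real.cosh_le_exp_half_sq ρ
    have h2 := Real.abs_exp_sub_one_le (x := ρ ^ 2 / 2)
      (by rw [abs_of_nonneg (by positivity)]; nlinarith)
    rw [abs_of_nonneg (a := ρ ^ 2 / 2) (by positivity)] at h2
    linarith [le_abs_self (Real.exp (ρ ^ 2 / 2) - 1)]
  have hcn : ‖c.1‖ < 1 := mem_ball_zero_iff.1 c.2
  have hxn : ‖x.1‖ < 1 := mem_ball_zero_iff.1 x.2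
  have hab : |‖c.1‖ - ‖x.1‖| ≤ ‖c.1 - x.1‖ := abs_norm_sub_norm_le _ _
  have hd : |(1 - ‖c.1‖ ^ 2) - (1 - ‖x.1‖ ^ 2)| ≤ 2 * ‖c.1 - x.1‖ := by
    have : (1 - ‖c.1‖ ^ 2) - (1 - ‖x.1‖ ^ 2) = -((‖c.1‖ + ‖x.1‖) * (‖c.1‖ - ‖x.1‖)) := by ring
    rw [this, abs_neg, abs_mul, abs_of_nonneg (by positivity)]
    exact mul_le_mul (by linarith) hab (abs_nonneg _) (by norm_num)
  have hd2 := pow_le_pow_left₀ (abs_nonneg _) hd 2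
  rw [sq_abs] at hd2
  set A := 1 - ‖c.1‖ ^ 2
  set B := 1 - ‖x.1‖ ^ 2
  have hAB := mul_pos ha hb
  have h1 : 2 * ‖c.1 - x.1‖ ^ 2 ≤ ρ ^ 2 * (A * B) :=
    h.trans (mul_le_mul_of_nonneg_right hcosh hAB.le)
  have hρ2 : ρ ^ 2 ≤ 1 := by nlinarith
  -- This keeps `A / B` between `1 / 4` and `4`: the conformal factor is comparable across the ball.
  have h2 : (A - B) ^ 2 ≤ 2 * (A * B) := by nlinarith
  have h3 : A ≤ 4 * B := by
    by_contra hlt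
    push Not at hlt
    nlinarith
  have h4 : B ≤ 4 * A := by
    by_contra hlt
    push Not at hlt
    nlinarith
  refine ⟨?_, h3⟩
  refine abs_le_of_sq_le_sq' ?_ (by positivity) |>.2
  have h5 : ρ ^ 2 * (A * B) ≤ ρ ^ 2 * (A * (4 * A)) := by gcongr
  nlinarith

/-- The density is at most `(8 / A) ^ n` on a set inside a Euclidean ball of radius `2 * ρ * A`; the
dependence on the center cancels. -/
theorem hypVolume_hypClosedBall_le (c : HypSpace n) {ρ : ℝ} (hρ : 0 ≤ ρ) (hρ1 : ρ ≤ 1) :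
    hypVolume n (hypClosedBall c ρ) ≤ ENNReal.ofReal ((16 * ρ) ^ n) *
      volume (Metric.ball (0 : EuclideanSpace ℝ (Fin n)) 1) := by
  have ha := one_sub_norm_sq_pos c
  set A := 1 - ‖c.1‖ ^ 2 with hA
  have hmeas : MeasurableSet (hypClosedBall c ρ) := (isClosed_hypClosedBall c hρ).measurableSet
  rw [hypVolume, withDensity_apply _ hmeas]
  have hdens : ∀ x ∈ hypClosedBall c ρ,
      ENNReal.ofReal ((2 / (1 - ‖x.1‖ ^ 2)) ^ n) ≤ ENNReal.ofReal ((8 / A) ^ n) := by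
    intro x hx
    have hx0 := one_sub_norm_sq_pos x
    have := (norm_sub_le_of_hypDist_le hρ hρ1 hx).2
    apply ENNReal.ofReal_le_ofReal
    apply pow_le_pow_left₀ (by positivity)
    rw [div_le_div_iff₀ hx0 ha]
    linarith
  refine (setLIntegral_mono' hmeas hdens).trans ?_
  rw [setLIntegral_const]
  have himage : Measure.comap Subtype.val (volume : Measure (EuclideanSpace ℝ (Fin n)))
      (hypClosedBall c ρ) ≤ volume (Metric.closedBall c.1 (2 * ρ * A)) := by
    rw [comap_subtype_coe_apply Metric.isOpen_ball.measurableSet]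
    apply measure_mono
    rintro _ ⟨x, hx, rfl⟩
    rw [mem_closedBall_iff_norm']
    exact (norm_sub_le_of_hypDist_le hρ hρ1 hx).1
  refine (mul_le_mul_right himage _).trans ?_
  rw [Measure.addHaar_closedBall _ _ (by positivity), ← mul_assoc,
    ← ENNReal.ofReal_mul (by positivity), finrank_euclideanSpace_fin, ← mul_pow]
  have : 8 / A * (2 * ρ * A) = 16 * ρ := by field_simp; ring
  rw [this]

theorem tsum_sq_div_le {r : ℝ} (hr : 0 < r) :
    Summable (fun i : ℕ => (r / (1 + r * i)) ^ 2) ∧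
      ∑' i : ℕ, (r / (1 + r * i)) ^ 2 ≤ r ^ 2 + r := by
  have hsum : ∀ N : ℕ, ∑ i ∈ Finset.range (N + 1), (r / (1 + r * i)) ^ 2 ≤
      r ^ 2 + r - r / (1 + r * N) := by
    intro N
    induction N with
    | zero => simp
    | succ k ih =>
      rw [Finset.sum_range_succ]
      have hk : 0 < 1 + r * k := by positivity
      push_cast
      have hk1 : 0 < 1 + r * (k + 1) := by positivity
      -- Telescoping: the difference equals `r ^ 2 / ((1 + r * k) * (1 + r * (k + 1)))`.
      have : (r / (1 + r * (k + 1))) ^ 2 ≤ r / (1 + r * k) - r / (1 + r * (k + 1)) := by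
        rw [div_sub_div _ _ hk.ne' hk1.ne', div_pow, div_le_div_iff₀ (by positivity) (by positivity)]
        have : r * (1 + r * (k + 1)) - (1 + r * k) * r = r ^ 2 := by ring
        rw [this]
        refine mul_le_mul_of_nonneg_left ?_ (by positivity)
        rw [sq]
        exact mul_le_mul_of_nonneg_right (by nlinarith) hk1.le
      linarith
  have hle : ∀ N : ℕ, ∑ i ∈ Finset.range N, (r / (1 + r * i)) ^ 2 ≤ r ^ 2 + r := by
    intro N
    refine (Finset.sum_le_sum_of_subset_of_nonneg (Finset.range_mono (Nat.le_succ N))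
      fun _ _ _ => by positivity).trans ((hsum N).trans ?_)
    have : 0 ≤ r / (1 + r * N) := by positivity
    linarith
  exact ⟨summable_of_sum_range_le (fun _ => by positivity) hle,
    Real.tsum_le_of_sum_range_le (fun _ => by positivity) hle⟩

theorem IsHypLine.hypVolume_hypSpindle_le {γ : ℝ → HypSpace n} (hγ : IsHypLine γ) (hn : 2 ≤ n)
    {r : ℝ} (hr : 0 < r) (hr1 : r ≤ 1 / 5) (a : ℝ) :
    hypVolume n (hypSpindle γ r a) ≤ ENNReal.ofReal (2 * 80 ^ n * (r ^ 2 + r)) *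
      volume (Metric.ball (0 : EuclideanSpace ℝ (Fin n)) 1) := by
  set ω := volume (Metric.ball (0 : EuclideanSpace ℝ (Fin n)) 1) with hω
  obtain ⟨hs, hle⟩ := tsum_sq_div_le hr
  have hball : ∀ (i : ℕ) (c : HypSpace n), hypVolume n (hypClosedBall c (5 * r / (1 + r * i))) ≤
      ENNReal.ofReal (80 ^ n * (r / (1 + r * i)) ^ 2) * ω := by
    intro i c
    have hp : 1 ≤ 1 + r * i := by
      have : 0 ≤ r * i := by positivity
      linarith
    have hp0 : 0 < 1 + r * i := by linarith
    refine (hypVolume_hypClosedBall_le c (by positivity) ?_).trans ?_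
    · rw [div_le_one hp0]
      linarith
    · gcongr
      have : 16 * (5 * r / (1 + r * i)) = 80 * (r / (1 + r * i)) := by ring
      rw [this, mul_pow]
      -- Dimension at least two enters here: exponent `n` is lowered to 2, the summable case, since
      -- the base is at most 1.
      refine mul_le_mul_of_nonneg_left (pow_le_pow_of_le_one (by positivity) ?_ hn) (by positivity)
      rw [div_le_one hp0]
      linarith
  refine (measure_mono (hγ.hypSpindle_subset_iUnion hr (by linarith) a)).trans ?_
  refine (measure_iUnion_le _).trans ?_
  calc _ ≤ ∑' i : ℕ, ENNReal.ofReal (2 * 80 ^ n * (r / (1 + r * i)) ^ 2) * ω := by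
        refine ENNReal.tsum_le_tsum fun i => (measure_union_le _ _).trans
          ((add_le_add (hball i _) (hball i _)).trans_eq ?_)
        rw [← add_mul, ← ENNReal.ofReal_add (by positivity) (by positivity)]
        ring_nf
    _ = ENNReal.ofReal (∑' i : ℕ, 2 * 80 ^ n * (r / (1 + r * i)) ^ 2) * ω := by
        rw [ENNReal.tsum_mul_right, ENNReal.ofReal_tsum_of_nonneg (fun _ => by positivity)
          (hs.mul_left _)]
    _ ≤ _ := by
        rw [tsum_mul_left]
        gcongr

theorem IsHypLine.tendsto_hypVolume_hypSpindle {γ : ℝ → HypSpace n} (hγ : IsHypLine γ)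
    (hn : 2 ≤ n) (g : ℝ → ℝ) :
    Tendsto (fun r => hypVolume n (hypSpindle γ r (g r))) (𝓝[>] 0) (𝓝 0) := by
  have hlim : Tendsto (fun r : ℝ => ENNReal.ofReal (2 * 80 ^ n * (r ^ 2 + r)) *
      volume (Metric.ball (0 : EuclideanSpace ℝ (Fin n)) 1)) (𝓝[>] 0) (𝓝 0) := by
    have h1 : Continuous fun r : ℝ => (2 * 80 ^ n * (r ^ 2 + r) : ℝ) := by fun_prop
    have h2 := (ENNReal.continuous_ofReal.comp h1).tendsto 0
    have h3 := ENNReal.Tendsto.mul_const (b := volume (Metric.ball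
      (0 : EuclideanSpace ℝ (Fin n)) 1)) h2 (Or.inr measure_ball_lt_top.ne)
    simpa using h3.mono_left nhdsWithin_le_nhds
  refine tendsto_of_tendsto_of_tendsto_of_le_of_le' tendsto_const_nhds hlim
    (Eventually.of_forall fun _ => zero_le) ?_
  filter_upwards [Ioo_mem_nhdsGT (show (0 : ℝ) < 1 / 5 by norm_num)] with r hr
  exact hγ.hypVolume_hypSpindle_le hn hr.1 hr.2.le _

end Volume

/-! ### Existence of a line, choice of the tip distance, and conclusion -/

theorem exists_isHypLine {n : ℕ} (hn : 0 < n) : ∃ γ : ℝ → HypSpace n, IsHypLine γ := by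
  set e : EuclideanSpace ℝ (Fin n) := EuclideanSpace.single ⟨0, hn⟩ 1 with he
  have hee : inner ℝ e e = (1 : ℝ) := by rw [real_inner_self_eq_norm_sq, he]; simp
  have h : ∀ t : ℝ, ∃ x : HypSpace n, toHyperboloid x = (Real.cosh t, Real.sinh t • e) := by
    intro t
    refine exists_toHyperboloid_eq (Real.cosh_pos t) ?_
    rw [lorentzForm_apply]
    simp only [inner_smul_left, inner_smul_right, hee, conj_trivial]
    linarith [Real.cosh_sq t]
  choose γ hγ using h
  refine ⟨γ, fun s t => ?_⟩
  have h1 : -lorentzForm _ (toHyperboloid (γ s)) (toHyperboloid (γ t)) = Real.cosh |s - t| := by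
    rw [hγ, hγ, lorentzForm_apply, Real.cosh_abs, Real.cosh_sub]
    simp only [inner_smul_left, inner_smul_right, hee, conj_trivial]
    ring
  rw [hypDist_eq, h1, Real.arcosh_cosh (abs_nonneg _)]

/-- Since `cosh` dominates the identity on nonnegative reals, this tip distance makes `sinh r * cosh
a ≥ sinh (1 / r)`. The summand 2 only serves to make the distance exceed 1. -/
theorem IsHypLine.one_div_le_minLassakWidth_hypSpindle {n : ℕ} (hn : 0 < n) {γ : ℝ → HypSpace n}
    (hγ : IsHypLine γ) {r : ℝ} (hr : 0 < r) :
    1 / r ≤ minLassakWidth (hypSpindle γ r (2 + Real.sinh (1 / r) / Real.sinh r)) := by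
  have hs : 0 < Real.sinh r := Real.sinh_pos_iff.2 hr
  have hw : 0 < Real.sinh (1 / r) := Real.sinh_pos_iff.2 (by positivity)
  refine le_minLassakWidth_of_line hn hγ (isCompact_hypSpindle γ hr.le _) hr.le
    (a := 2 + Real.sinh (1 / r) / Real.sinh r)
    (fun x hx => subset_hypConvexHull _ (Or.inl hx))
    (subset_hypConvexHull _ (Or.inr (by simp))) (subset_hypConvexHull _ (Or.inr (by simp))) ?_
  set a := Real.sinh (1 / r) / Real.sinh r with ha
  have h1 : a ≤ Real.cosh (2 + a) := by
    have h2 : 0 ≤ 2 + a := by positivity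
    linarith [Real.self_le_sinh_iff.2 h2, Real.sinh_lt_cosh (2 + a)]
  calc Real.sinh (1 / r) = Real.sinh r * a := by rw [ha]; field_simp
    _ ≤ _ := mul_le_mul_of_nonneg_left h1 hs.le

theorem theorem1p2 :
    (∀ n : ℕ, 2 ≤ n → ∀ w : ℝ, 0 < w →
      sInf {v : ℝ≥0∞ | ∃ K : Set (HypSpace n),
        IsHypConvexBody K ∧ w ≤ minLassakWidth K ∧ v = hypVolume n K} = 0) ∧
    (∃ g : ℝ → ℝ, (∀ r ∈ Ioo (0 : ℝ) (1 / 2), 1 < g r) ∧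
      ∀ n : ℕ, 2 ≤ n → ∀ γ : ℝ → HypSpace n, IsHypLine γ →
        (∀ r ∈ Ioo (0 : ℝ) (1 / 2),
          IsHypConvexBody (hypSpindle γ r (g r)) ∧
          1 / r ≤ minLassakWidth (hypSpindle γ r (g r))) ∧
        Tendsto (fun r => minLassakWidth (hypSpindle γ r (g r))) (𝓝[>] 0) atTop ∧
        Tendsto (fun r => hypVolume n (hypSpindle γ r (g r))) (𝓝[>] 0) (𝓝 0)) := by
  set g : ℝ → ℝ := fun r => 2 + Real.sinh (1 / r) / Real.sinh r with hg
  have hwidth : ∀ n : ℕ, 2 ≤ n → ∀ γ : ℝ → HypSpace n, IsHypLine γ → ∀ r : ℝ, 0 < r →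
      1 / r ≤ minLassakWidth (hypSpindle γ r (g r)) :=
    fun n hn γ hγ r hr => hγ.one_div_le_minLassakWidth_hypSpindle (by omega) hr
  have hlim : ∀ n : ℕ, 2 ≤ n → ∀ γ : ℝ → HypSpace n, IsHypLine γ →
      Tendsto (fun r => minLassakWidth (hypSpindle γ r (g r))) (𝓝[>] 0) atTop := by
    intro n hn γ hγ
    have h0 : Tendsto (fun r : ℝ => 1 / r) (𝓝[>] 0) atTop := by
      simpa only [one_div] using tendsto_inv_nhdsGT_zero (𝕜 := ℝ)
    refine tendsto_atTop_mono' _ ?_ h0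
    filter_upwards [self_mem_nhdsWithin] with r hr
    exact hwidth n hn γ hγ r hr
  refine ⟨fun n hn w _ => ?_, g, fun r hr => ?_, fun n hn γ hγ => ⟨fun r hr =>
    ⟨isHypConvexBody_hypSpindle γ hr.1 _, hwidth n hn γ hγ r hr.1⟩, hlim n hn γ hγ,
    hγ.tendsto_hypVolume_hypSpindle hn g⟩⟩
  · obtain ⟨γ, hγ⟩ := exists_isHypLine (n := n) (by omega)
    -- For small `r` the spindle is admissible for the given `w`, so the infimum lies below volumes
    -- tending to zero.
    refine le_antisymm (ge_of_tendsto (hγ.tendsto_hypVolume_hypSpindle hn g) ?_) zero_le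
    filter_upwards [(hlim n hn γ hγ).eventually_ge_atTop w, self_mem_nhdsWithin] with r hw hr
    exact sInf_le ⟨_, isHypConvexBody_hypSpindle γ hr _, hw, rfl⟩
  · have h1 : 0 < Real.sinh r := Real.sinh_pos_iff.2 hr.1
    have h2 : 0 < Real.sinh (1 / r) := Real.sinh_pos_iff.2 (one_div_pos.2 hr.1)
    have h3 : 0 < Real.sinh (1 / r) / Real.sinh r := div_pos h2 h1
    change 1 < 2 + Real.sinh (1 / r) / Real.sinh r
    linarith
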